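/- A complex structure on a real Lie algebra $\mathfrak g$ is a linear map $J:\mathfrak g\to\mathfrak g$ with $J^2=-I$ and $[Jx,Jy]-[x,y]-J[Jx,y]-J[x,Jy]=0$ for all $x,y$. A symplectic structure is a nondegenerate alternating bilinear form $\omega$ on $\mathfrak g$ with $\omega([x,y],z)+\omega([y,z],x)+\omega([z,x],y)=0$; it is compatible with $J$ if $\omega(Jx,Jy)=\omega(x,y)$. A Kähler Lie algebra $(\mathfrak g,J,\omega)$ is a real Lie algebra with a complex structure $J$ and a compatible symplectic structure $\omega$ (the metric $\omega(J\cdot,\cdot)$ may be indefinite). Consider the following table of Lie algebras with basis $e_1,e_2,e_3,e_4$ (brackets of basis vectors that are not listed and do not follow by antisymmetry vanish), complex structures $J$ (completed by $J^2=-I$), and sets of two-forms, where $e^{ij}=e^i\wedge e^j$ for the dual basis $(e^i)$, and $a,b,c$ range over the real numbers subject to the stated condition. 1. $\mathbb R\times\mathfrak h_3$: $[e_1,e_2]=e_3$. $Je_1=e_2$, $Je_3=e_4$: $a(e^{13}+e^{24})+b(e^{14}-e^{23})+c\,e^{12}$, $a^2+b^2\ne0$. 2. $\mathbb R^2\times\mathfrak{aff}(\mathbb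 R)$: $[e_1,e_2]=e_2$. $Je_1=e_2$, $Je_3=e_4$: $a\,e^{12}+b\,e^{34}$, $ab\ne0$. 3. $\mathbb R\times\mathfrak e(2)$: $[e_1,e_2]=-e_3$, $[e_1,e_3]=e_2$. $Je_1=e_4$, $Je_2=e_3$: $a\,e^{14}+b\,e^{23}$, $ab\ne0$. 4. $\mathfrak{aff}(\mathbb R)\times\mathfrak{aff}(\mathbb R)$: $[e_1,e_2]=e_2$, $[e_3,e_4]=e_4$. $Je_1=e_2$, $Je_3=e_4$: $a\,e^{12}+b\,e^{34}$, $ab\ne0$. 5. $\mathfrak{aff}(\mathbb C)$: $[e_1,e_3]=e_3$, $[e_1,e_4]=e_4$, $[e_2,e_3]=e_4$, $[e_2,e_4]=-e_3$. $J_1e_1=e_3$, $J_1e_2=e_4$: $a(e^{13}-e^{24})+b(e^{14}+e^{23})$, $a^2+b^2\ne0$. $J_2e_1=-e_2$, $J_2e_3=e_4$: $a(e^{13}-e^{24})+b(e^{14}+e^{23})+c\,e^{12}$, $a^2+b^2\ne0$. 6. $\mathfrak r_{4,-1,-1}$: $[e_4,e_1]=e_1$, $[e_4,e_2]=-e_2$,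 $[e_4,e_3]=-e_3$. $Je_4=e_1$, $Je_2=e_3$: $a(e^{12}+e^{34})+b(e^{13}-e^{24})+c\,e^{14}$, $a^2+b^2\ne0$. 7. $\mathfrak r'_{4,0,\delta}$, $\delta>0$: $[e_4,e_1]=e_1$, $[e_4,e_2]=-\delta e_3$, $[e_4,e_3]=\delta e_2$. Two complex structures, $J_1e_4=e_1$, $J_1e_2=e_3$ and $J_2e_4=e_1$, $J_2e_2=-e_3$; for each of them: $a\,e^{14}+b\,e^{23}$, $ab\ne0$. 8. $\mathfrak d_{4,1}$: $[e_1,e_2]=e_3$, $[e_4,e_3]=e_3$, $[e_4,e_1]=e_1$. $Je_1=e_4$, $Je_2=e_3$: $a(e^{12}-e^{34})+b\,e^{14}$, $a\ne0$. 9. $\mathfrak d_{4,2}$: $[e_1,e_2]=e_3$, $[e_4,e_3]=e_3$, $[e_4,e_1]=2e_1$, $[e_4,e_2]=-e_2$. $J_1e_4=-e_2$, $J_1e_1=e_3$: $a(e^{14}+e^{23})+b\,e^{24}$, $a\ne0$. $J_2e_4=-2e_1$, $J_2e_2=e_3$: $a\,e^{14}+b\,e^{23}$, $ab\ne0$. 10.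 $\mathfrak d_{4,1/2}$: $[e_1,e_2]=e_3$, $[e_4,e_3]=e_3$, $[e_4,e_1]=\tfrac12e_1$, $[e_4,e_2]=\tfrac12e_2$. Two complex structures, $J_1e_4=e_3$, $J_1e_1=e_2$ and $J_2e_4=e_3$, $J_2e_1=-e_2$; for each of them: $a(e^{12}-e^{34})$, $a\ne0$. 11. $\mathfrak d'_{4,\delta}$, $\delta>0$: $[e_1,e_2]=e_3$, $[e_4,e_1]=\tfrac\delta2e_1-e_2$, $[e_4,e_2]=e_1+\tfrac\delta2e_2$, $[e_4,e_3]=\delta e_3$. Four complex structures, $J_1e_4=e_3$, $J_1e_1=e_2$; $J_2e_4=-e_3$, $J_2e_1=e_2$; $J_3e_4=-e_3$, $J_3e_1=-e_2$; $J_4e_4=e_3$, $J_4e_1=-e_2$; for each of them: $a(e^{12}-\delta e^{34})$, $a\ne0$. **Proposition.** (i) Let $(\mathfrak g,J,\omega)$ be a non-abelian four-dimensional Kähler Lie algebra. Then there are a Lie algebra $\mathfrak g_0$ of the table, a complex structure $J_0$ listed for it, and a Lie algebra isomorphism $\varphi:\mathfrak g\to\mathfrak g_0$ with $\varphi\circ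 J=J_0\circ\varphi$ such that $\omega=\varphi^*\omega_0$ for one of the two-forms $\omega_0$ listed for $(\mathfrak g_0,J_0)$. (ii) If $\mathfrak g_0$ is a Lie algebra of the table and $J$ is a complex structure on $\mathfrak g_0$ that admits a compatible symplectic structure, then there are an automorphism $\varphi$ of $\mathfrak g_0$ and a complex structure $J_0$ listed for $\mathfrak g_0$ with $\varphi\circ J=J_0\circ\varphi$. (iii) Every listed $J_0$ is a complex structure on the corresponding $\mathfrak g_0$, and the symplectic structures on $\mathfrak g_0$ compatible with $J_0$ are exactly the listed two-forms. -/

import Mathlib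

/-- An integrable almost complex structure on a real Lie algebra: `J ^ 2 = -1` and `N_J = 0`. -/
def IsComplexStructure {g : Type*} [LieRing g] [LieAlgebra ℝ g] (J : g →ₗ[ℝ] g) : Prop :=
  (∀ x, J (J x) = -x) ∧
    ∀ x y, ⁅J x, J y⁆ - ⁅x, y⁆ - J ⁅J x, y⁆ - J ⁅x, J y⁆ = 0

/-- A symplectic structure on a (finite-dimensional) real Lie algebra: an alternating bilinear form
which is closed for the Lie algebra differential and nondegenerate. -/
def IsSymplecticStructure {g : Type*} [LieRing g] [LieAlgebra ℝ g]
    (ω : LinearMap.BilinForm ℝ g) : Prop :=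
  (∀ x, ω x x = 0) ∧
    (∀ x y z, ω ⁅x, y⁆ z + ω ⁅y, z⁆ x + ω ⁅z, x⁆ y = 0) ∧
    ∀ x, (∀ y, ω x y = 0) → x = 0

/-- The set of symplectic structures compatible with `J`, i.e. with `ω (J x) (J y) = ω x y`. -/
def compatibleSymplectic {g : Type*} [LieRing g] [LieAlgebra ℝ g] (J : g →ₗ[ℝ] g) :
    Set (LinearMap.BilinForm ℝ g) :=
  {ω | IsSymplecticStructure ω ∧ ∀ x y, ω (J x) (J y) = ω x y}

/-- A Kähler structure on a real Lie algebra: a complex structure and a compatible symplectic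
structure. -/
def IsKahlerStructure {g : Type*} [LieRing g] [LieAlgebra ℝ g] (J : g →ₗ[ℝ] g)
    (ω : LinearMap.BilinForm ℝ g) : Prop :=
  IsComplexStructure J ∧ ω ∈ compatibleSymplectic J

/-- Names of families of four-dimensional solvable real Lie algebras. -/
inductive LieName : Type
  /-- `ℝ × h₃`: `[e₁,e₂] = e₃`. -/
  | rh3
  /-- `ℝ × r_{3,a}`: `[e₁,e₂] = e₂`, `[e₁,e₃] = a e₃`. -/
  | rr3 (a : ℝ)
  /-- `ℝ × r'_{3,c}`: `[e₁,e₂] = c e₂ - e₃`, `[e₁,e₃] = e₂ + c e₃`. -/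
  | rr3' (c : ℝ)
  /-- `aff(ℝ) × aff(ℝ)`: `[e₁,e₂] = e₂`, `[e₃,e₄] = e₄`. -/
  | r2r2
  /-- `aff(ℂ)`: `[e₁,e₃] = e₃`, `[e₁,e₄] = e₄`, `[e₂,e₃] = e₄`, `[e₂,e₄] = -e₃`. -/
  | r2'
  /-- `r_{4,a,b}`: `[e₄,e₁] = e₁`, `[e₄,e₂] = a e₂`, `[e₄,e₃] = b e₃`. -/
  | r4 (a b : ℝ)
  /-- `r'_{4,c,δ}`: `[e₄,e₁] = e₁`, `[e₄,e₂] = c e₂ - δ e₃`, `[e₄,e₃] = δ e₂ + c e₃`. -/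
  | r4' (c δ : ℝ)
  /-- `d_{4,a}`: `[e₁,e₂] = e₃`, `[e₄,e₃] = e₃`, `[e₄,e₁] = a e₁`, `[e₄,e₂] = (1 - a) e₂`. -/
  | d4 (a : ℝ)
  /-- `d'_{4,δ}`: `[e₁,e₂] = e₃`, `[e₄,e₁] = (δ/2) e₁ - e₂`, `[e₄,e₃] = δ e₃`,
  `[e₄,e₂] = e₁ + (δ/2) e₂`. -/
  | d4' (δ : ℝ)

namespace LieName

/-- The bracket in the coordinates `(x 0, x 1, x 2, x 3)` with respect to `e₁, e₂, e₃, e₄`. -/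
noncomputable def bracket (A : LieName) (x y : Fin 4 → ℝ) : Fin 4 → ℝ :=
  let p : Fin 4 → Fin 4 → ℝ := fun i j => x i * y j - x j * y i
  match A with
  | rh3 => ![0, 0, p 0 1, 0]
  | rr3 a => ![0, p 0 1, a * p 0 2, 0]
  | rr3' c => ![0, c * p 0 1 + p 0 2, -p 0 1 + c * p 0 2, 0]
  | r2r2 => ![0, p 0 1, 0, p 2 3]
  | r2' => ![0, 0, p 0 2 - p 1 3, p 0 3 + p 1 2]
  | r4 a b => ![p 3 0, a * p 3 1, b * p 3 2, 0]
  | r4' c δ => ![p 3 0, c * p 3 1 + δ * p 3 2, -δ * p 3 1 + c * p 3 2, 0]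
  | d4 a => ![a * p 3 0, (1 - a) * p 3 1, p 0 1 + p 3 2, 0]
  | d4' δ => ![δ / 2 * p 3 0 + p 3 1, -p 3 0 + δ / 2 * p 3 1, p 0 1 + δ * p 3 2, 0]

/-- The underlying space `ℝ⁴` of the Lie algebra with name `A` (a type synonym that carries the
bracket of `A`). -/
def Alg (_A : LieName) : Type := Fin 4 → ℝ

variable (A : LieName)

noncomputable instance : AddCommGroup A.Alg := inferInstanceAs (AddCommGroup (Fin 4 → ℝ))

noncomputable instance : Module ℝ A.Alg := inferInstanceAs (Module ℝ (Fin 4 → ℝ))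

noncomputable instance : Bracket A.Alg A.Alg := ⟨fun x y => A.bracket x y⟩

theorem bracket_add_left (x y z : Fin 4 → ℝ) :
    A.bracket (x + y) z = A.bracket x z + A.bracket y z := by
  cases A <;> ext i <;> fin_cases i <;> simp [bracket] <;> ring

theorem bracket_add_right (x y z : Fin 4 → ℝ) :
    A.bracket x (y + z) = A.bracket x y + A.bracket x z := by
  cases A <;> ext i <;> fin_cases i <;> simp [bracket] <;> ring

theorem bracket_self (x : Fin 4 → ℝ) : A.bracket x x = 0 := by
  cases A <;> ext i <;> fin_cases i <;> simp [bracket, mul_comm]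

theorem bracket_smul_right (t : ℝ) (x y : Fin 4 → ℝ) :
    A.bracket x (t • y) = t • A.bracket x y := by
  cases A <;> ext i <;> fin_cases i <;> simp [bracket] <;> ring

theorem bracket_leibniz (x y z : Fin 4 → ℝ) :
    A.bracket x (A.bracket y z) = A.bracket (A.bracket x y) z + A.bracket y (A.bracket x z) := by
  cases A <;> ext i <;> fin_cases i <;> simp [bracket] <;> ring

noncomputable instance : LieRing A.Alg where
  add_lie := A.bracket_add_left
  lie_add := A.bracket_add_right
  lie_self := A.bracket_self
  leibniz_lie := A.bracket_leibniz

noncomputable instance : LieAlgebra ℝ A.Alg where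
  lie_smul := A.bracket_smul_right

/-- The basis `e₁, e₂, e₃, e₄` of `A.Alg`. -/
noncomputable def basis : Module.Basis (Fin 4) ℝ A.Alg := Pi.basisFun ℝ (Fin 4)

/-- `A.e 0, A.e 1, A.e 2, A.e 3` are `e₁, e₂, e₃, e₄` (the index is shifted by one). -/
noncomputable def e (i : Fin 4) : A.Alg := A.basis i

/-- The dual basis: `A.dual 0, A.dual 1, A.dual 2, A.dual 3` are `e¹, e², e³, e⁴`. -/
noncomputable def dual (i : Fin 4) : A.Alg →ₗ[ℝ] ℝ := A.basis.coord i

/-- The two-forms `e^{ij} = e^i ∧ e^j`, with indices shifted by one: `A.w 0 1` is `e^{12}`. -/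
noncomputable def w (i j : Fin 4) : LinearMap.BilinForm ℝ A.Alg :=
  LinearMap.BilinForm.linMulLin (A.dual i) (A.dual j) -
    LinearMap.BilinForm.linMulLin (A.dual j) (A.dual i)

/-- The endomorphism with `e₁ ↦ v₁`, `e₂ ↦ v₂`, `e₃ ↦ v₃`, `e₄ ↦ v₄`. -/
noncomputable def endo (v₁ v₂ v₃ v₄ : A.Alg) : A.Alg →ₗ[ℝ] A.Alg :=
  A.basis.constr ℝ ![v₁, v₂, v₃, v₄]

end LieName

open LieName in
/-- The table of Kähler Lie algebras. `KahlerTable A J S` says that the Lie algebra `A`, the complex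
structure `J` on it, and the set `S` of two-forms form a line of the table.
In the code the indices of `e` and `w` run from `0` to `3`; in the comments they run from `1` to `4`. -/
inductive KahlerTable :
    (A : LieName) → (A.Alg →ₗ[ℝ] A.Alg) → Set (LinearMap.BilinForm ℝ A.Alg) → Prop
  /-- `ℝ × h₃`: `J e₁ = e₂`, `J e₃ = e₄`. -/
  | rh3 : KahlerTable rh3 (endo rh3 (e _ 1) (-e _ 0) (e _ 3) (-e _ 2))
      {ω | ∃ a b c : ℝ, a ^ 2 + b ^ 2 ≠ 0 ∧
        ω = a • (w _ 0 2 + w _ 1 3) + b • (w _ 0 3 - w _ 1 2) + c • w _ 0 1}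
  /-- `ℝ² × aff(ℝ)`: `J e₁ = e₂`, `J e₃ = e₄`. -/
  | rr30 : KahlerTable (rr3 0) (endo (rr3 0) (e _ 1) (-e _ 0) (e _ 3) (-e _ 2))
      {ω | ∃ a b : ℝ, a * b ≠ 0 ∧ ω = a • w _ 0 1 + b • w _ 2 3}
  /-- `ℝ × e(2)`: `J e₁ = e₄`, `J e₂ = e₃`. -/
  | rr30' : KahlerTable (rr3' 0) (endo (rr3' 0) (e _ 3) (e _ 2) (-e _ 1) (-e _ 0))
      {ω | ∃ a b : ℝ, a * b ≠ 0 ∧ ω = a • w _ 0 3 + b • w _ 1 2}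
  /-- `aff(ℝ) × aff(ℝ)`: `J e₁ = e₂`, `J e₃ = e₄`. -/
  | r2r2 : KahlerTable r2r2 (endo r2r2 (e _ 1) (-e _ 0) (e _ 3) (-e _ 2))
      {ω | ∃ a b : ℝ, a * b ≠ 0 ∧ ω = a • w _ 0 1 + b • w _ 2 3}
  /-- `aff(ℂ)`: `J₁ e₁ = e₃`, `J₁ e₂ = e₄`. -/
  | r2'_J1 : KahlerTable r2' (endo r2' (e _ 2) (e _ 3) (-e _ 0) (-e _ 1))
      {ω | ∃ a b : ℝ, a ^ 2 + b ^ 2 ≠ 0 ∧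
        ω = a • (w _ 0 2 - w _ 1 3) + b • (w _ 0 3 + w _ 1 2)}
  /-- `aff(ℂ)`: `J₂ e₁ = -e₂`, `J₂ e₃ = e₄`. -/
  | r2'_J2 : KahlerTable r2' (endo r2' (-e _ 1) (e _ 0) (e _ 3) (-e _ 2))
      {ω | ∃ a b c : ℝ, a ^ 2 + b ^ 2 ≠ 0 ∧
        ω = a • (w _ 0 2 - w _ 1 3) + b • (w _ 0 3 + w _ 1 2) + c • w _ 0 1}
  /-- `r_{4,-1,-1}`: `J e₄ = e₁`, `J e₂ = e₃`. -/
  | r4 : KahlerTable (r4 (-1) (-1)) (endo (r4 (-1) (-1)) (-e _ 3) (e _ 2) (-e _ 1) (e _ 0))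
      {ω | ∃ a b c : ℝ, a ^ 2 + b ^ 2 ≠ 0 ∧
        ω = a • (w _ 0 1 + w _ 2 3) + b • (w _ 0 2 - w _ 1 3) + c • w _ 0 3}
  /-- `r'_{4,0,δ}`: `J₁ e₄ = e₁`, `J₁ e₂ = e₃`. -/
  | r4'_J1 (δ : ℝ) (hδ : 0 < δ) :
      KahlerTable (r4' 0 δ) (endo (r4' 0 δ) (-e _ 3) (e _ 2) (-e _ 1) (e _ 0))
      {ω | ∃ a b : ℝ, a * b ≠ 0 ∧ ω = a • w _ 0 3 + b • w _ 1 2}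
  /-- `r'_{4,0,δ}`: `J₂ e₄ = e₁`, `J₂ e₂ = -e₃`. -/
  | r4'_J2 (δ : ℝ) (hδ : 0 < δ) :
      KahlerTable (r4' 0 δ) (endo (r4' 0 δ) (-e _ 3) (-e _ 2) (e _ 1) (e _ 0))
      {ω | ∃ a b : ℝ, a * b ≠ 0 ∧ ω = a • w _ 0 3 + b • w _ 1 2}
  /-- `d_{4,1}`: `J e₁ = e₄`, `J e₂ = e₃`. -/
  | d41 : KahlerTable (d4 1) (endo (d4 1) (e _ 3) (e _ 2) (-e _ 1) (-e _ 0))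
      {ω | ∃ a b : ℝ, a ≠ 0 ∧ ω = a • (w _ 0 1 - w _ 2 3) + b • w _ 0 3}
  /-- `d_{4,2}`: `J₁ e₄ = -e₂`, `J₁ e₁ = e₃`. -/
  | d42_J1 : KahlerTable (d4 2) (endo (d4 2) (e _ 2) (e _ 3) (-e _ 0) (-e _ 1))
      {ω | ∃ a b : ℝ, a ≠ 0 ∧ ω = a • (w _ 0 3 + w _ 1 2) + b • w _ 1 3}
  /-- `d_{4,2}`: `J₂ e₄ = -2 e₁`, `J₂ e₂ = e₃`. -/
  | d42_J2 : KahlerTable (d4 2)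
      (endo (d4 2) ((1 / 2 : ℝ) • e _ 3) (e _ 2) (-e _ 1) ((-2 : ℝ) • e _ 0))
      {ω | ∃ a b : ℝ, a * b ≠ 0 ∧ ω = a • w _ 0 3 + b • w _ 1 2}
  /-- `d_{4,1/2}`: `J₁ e₄ = e₃`, `J₁ e₁ = e₂`. -/
  | d4half_J1 : KahlerTable (d4 (1 / 2)) (endo (d4 (1 / 2)) (e _ 1) (-e _ 0) (-e _ 3) (e _ 2))
      {ω | ∃ a : ℝ, a ≠ 0 ∧ ω = a • (w _ 0 1 - w _ 2 3)}
  /-- `d_{4,1/2}`: `J₂ e₄ = e₃`, `J₂ e₁ = -e₂`. -/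
  | d4half_J2 : KahlerTable (d4 (1 / 2)) (endo (d4 (1 / 2)) (-e _ 1) (e _ 0) (-e _ 3) (e _ 2))
      {ω | ∃ a : ℝ, a ≠ 0 ∧ ω = a • (w _ 0 1 - w _ 2 3)}
  /-- `d'_{4,δ}`: `J₁ e₄ = e₃`, `J₁ e₁ = e₂`. -/
  | d4'_J1 (δ : ℝ) (hδ : 0 < δ) :
      KahlerTable (d4' δ) (endo (d4' δ) (e _ 1) (-e _ 0) (-e _ 3) (e _ 2))
      {ω | ∃ a : ℝ, a ≠ 0 ∧ ω = a • (w _ 0 1 - δ • w _ 2 3)}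
  /-- `d'_{4,δ}`: `J₂ e₄ = -e₃`, `J₂ e₁ = e₂`. -/
  | d4'_J2 (δ : ℝ) (hδ : 0 < δ) :
      KahlerTable (d4' δ) (endo (d4' δ) (e _ 1) (-e _ 0) (e _ 3) (-e _ 2))
      {ω | ∃ a : ℝ, a ≠ 0 ∧ ω = a • (w _ 0 1 - δ • w _ 2 3)}
  /-- `d'_{4,δ}`: `J₃ e₄ = -e₃`, `J₃ e₁ = -e₂`. -/
  | d4'_J3 (δ : ℝ) (hδ : 0 < δ) :
      KahlerTable (d4' δ) (endo (d4' δ) (-e _ 1) (e _ 0) (e _ 3) (-e _ 2))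
      {ω | ∃ a : ℝ, a ≠ 0 ∧ ω = a • (w _ 0 1 - δ • w _ 2 3)}
  /-- `d'_{4,δ}`: `J₄ e₄ = e₃`, `J₄ e₁ = -e₂`. -/
  | d4'_J4 (δ : ℝ) (hδ : 0 < δ) :
      KahlerTable (d4' δ) (endo (d4' δ) (-e _ 1) (e _ 0) (-e _ 3) (e _ 2))
      {ω | ∃ a : ℝ, a ≠ 0 ∧ ω = a • (w _ 0 1 - δ • w _ 2 3)}

/-! The complex structure makes the Lie algebra a complex plane. Integrability says that the bracket
has no component conjugate-linear in both arguments, so [x,y] = S(x,y) + M_x y - M_y x, with S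
complex bilinear and alternating, M_x complex linear, and M conjugate-linear in x
(`exists_holomorphicSplitting`). For the pseudo-hermitian form h with imaginary part -ω, closedness
of ω gives h(S(x,y),z) = h(x,M_y z) - h(y,M_x z), so M determines S. One component of the Jacobi
identity is [M_x,M_y] = M_{S(x,y)}. Hence the operators M_x form a solvable Lie algebra on a plane
and share an eigenvector w (`exists_common_eigenvector`).

If w is null, it is completed to a basis of two null vectors; otherwise it is paired with an
orthogonal vector. Either way six complex numbers a, ..., f remain, together with the ratio ε of the
norms in the second case. The Jacobi identity becomes a short list of polynomial equations, and
every branch of their solution is brought to a line of the table by a change of complex basis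
(`inKahlerTable_null`, `inKahlerTable_nonNull`).

Part (iii) is linear algebra in the six coefficients of an alternating form on ℝ⁴, with the Pfaffian
expressing nondegeneracy. It also completes (i): once J is matched, the transported ω is compatible
with the listed J₀, hence listed. For (ii), the classification gives some algebra of the table
isomorphic to the given one; the traces of (ad x)^k for k = 1, 2, 3 show that it is the same one
(`eq_of_equiv_of_kahlerTable`). -/

section KahlerLieAlgebras

open LieName

/-! ### Alternating forms and compatible symplectic structures in coordinates -/

/-- The alternating form on `ℝ⁴` with coefficient `m i j` on `eⁱ ∧ eʲ`, in coordinates. -/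
def altForm (a b c d e f : ℝ) (x y : Fin 4 → ℝ) : ℝ :=
  a * (x 0 * y 1 - x 1 * y 0) + b * (x 0 * y 2 - x 2 * y 0) + c * (x 0 * y 3 - x 3 * y 0) +
    d * (x 1 * y 2 - x 2 * y 1) + e * (x 1 * y 3 - x 3 * y 1) + f * (x 2 * y 3 - x 3 * y 2)

namespace LieName

variable (A : LieName)

theorem lie_eq_bracket (x y : A.Alg) : ⁅x, y⁆ = A.bracket x y := rfl

theorem e_eq_single (i : Fin 4) : A.e i = (Pi.single i 1 : Fin 4 → ℝ) := by
  simp only [e, basis]; exact Pi.basisFun_apply ℝ (Fin 4) i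

theorem w_apply (i j : Fin 4) (x y : A.Alg) :
    A.w i j x y = (x : Fin 4 → ℝ) i * (y : Fin 4 → ℝ) j -
      (x : Fin 4 → ℝ) j * (y : Fin 4 → ℝ) i := rfl

theorem endo_apply (v₁ v₂ v₃ v₄ x : A.Alg) (i : Fin 4) :
    (A.endo v₁ v₂ v₃ v₄ x : Fin 4 → ℝ) i =
      (x : Fin 4 → ℝ) 0 * (v₁ : Fin 4 → ℝ) i + (x : Fin 4 → ℝ) 1 * (v₂ : Fin 4 → ℝ) i +
      (x : Fin 4 → ℝ) 2 * (v₃ : Fin 4 → ℝ) i + (x : Fin 4 → ℝ) 3 * (v₄ : Fin 4 → ℝ) i := by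
  have h : A.endo v₁ v₂ v₃ v₄ x =
      (x : Fin 4 → ℝ) 0 • v₁ + (x : Fin 4 → ℝ) 1 • v₂ +
      (x : Fin 4 → ℝ) 2 • v₃ + (x : Fin 4 → ℝ) 3 • v₄ := by
    rw [endo, Module.Basis.constr_apply_fintype, Fin.sum_univ_four]; rfl
  rw [h]; rfl

/-- The alternating form with given coefficients, as a bilinear form. -/
noncomputable def form (a b c d e f : ℝ) : LinearMap.BilinForm ℝ A.Alg :=
  a • A.w 0 1 + b • A.w 0 2 + c • A.w 0 3 + d • A.w 1 2 + e • A.w 1 3 + f • A.w 2 3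

theorem form_apply (a b c d e f : ℝ) (x y : A.Alg) :
    A.form a b c d e f x y = altForm a b c d e f x y := by
  simp only [form, LinearMap.add_apply, LinearMap.smul_apply, w_apply, smul_eq_mul, altForm]

theorem eq_form_of_alternating (ω : LinearMap.BilinForm ℝ A.Alg) (h : ∀ x, ω x x = 0) :
    ω = A.form (ω (A.e 0) (A.e 1)) (ω (A.e 0) (A.e 2)) (ω (A.e 0) (A.e 3))
      (ω (A.e 1) (A.e 2)) (ω (A.e 1) (A.e 3)) (ω (A.e 2) (A.e 3)) := by
  have hs : ∀ x y, ω x y = -ω y x := fun x y => by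
    have := h (x + y)
    simp only [map_add, LinearMap.add_apply, h] at this
    linarith
  refine LinearMap.BilinForm.ext_basis A.basis fun i j => ?_
  change ω (A.e i) (A.e j) = A.form _ _ _ _ _ _ (A.e i) (A.e j)
  rw [form_apply, e_eq_single, e_eq_single, altForm]
  fin_cases i <;> fin_cases j <;> simp [e_eq_single] <;> first | exact h _ | exact hs _ _

end LieName

/-- The Pfaffian criterion for nondegeneracy of an alternating form on `ℝ⁴`. -/
theorem altForm_nondegenerate_iff (a b c d e f : ℝ) :
    (∀ x : Fin 4 → ℝ, (∀ y, altForm a b c d e f x y = 0) → x = 0) ↔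
      a * f - b * e + c * d ≠ 0 := by
  constructor
  · intro h hp
    -- The vectors are rows of the Pfaffian adjoint, whose product with the matrix of the form is
    -- the Pfaffian times the identity. If the Pfaffian vanishes they lie in the radical, so all
    -- coefficients vanish and e₁ lies in the radical too.
    have h1 := h ![0, f, -e, d] fun y => by
      simp [altForm]; linear_combination -(y 0) * hp
    have h2 := h ![-f, 0, c, -b] fun y => by
      simp [altForm]; linear_combination -(y 1) * hp
    have h3 := h ![e, -c, 0, a] fun y => by
      simp [altForm]; linear_combination -(y 2) * hp
    have hf := congrFun h1 1
    have he := congrFun h1 2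
    have hd := congrFun h1 3
    have hc := congrFun h2 2
    have hb := congrFun h2 3
    have ha := congrFun h3 3
    simp at ha hb hc hd he hf
    subst ha hb hc hd he hf
    have h4 := h ![1, 0, 0, 0] fun y => by simp [altForm]
    simpa using congrFun h4 0
  · intro hp x hx
    have h0 := hx ![1, 0, 0, 0]
    have h1 := hx ![0, 1, 0, 0]
    have h2 := hx ![0, 0, 1, 0]
    have h3 := hx ![0, 0, 0, 1]
    simp [altForm] at h0 h1 h2 h3
    funext i
    refine (mul_eq_zero.1 (?_ : (a * f - b * e + c * d) * x i = 0)).resolve_left hp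
    fin_cases i <;> simp only [Fin.zero_eta, Fin.mk_one, Fin.reduceFinMk]
    -- The same adjoint matrix recovers Pf · x from the pairings of x with the basis.
    · linear_combination f * h1 - e * h2 + d * h3
    · linear_combination -f * h0 - b * h3 + c * h2
    · linear_combination e * h0 + a * h3 - c * h1
    · linear_combination -d * h0 - a * h2 + b * h1

/-- An explicit coordinate formula `j` for `J` turns every condition into polynomial identities in
the six coefficients and the coordinates. -/
theorem mem_compatibleSymplectic_iff {A : LieName} {J : A.Alg →ₗ[ℝ] A.Alg}
    (j : (Fin 4 → ℝ) → Fin 4 → ℝ) (hJ : ∀ x, J x = j x) (ω : LinearMap.BilinForm ℝ A.Alg) :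
    ω ∈ compatibleSymplectic J ↔ ∃ a b c d e f : ℝ, ω = A.form a b c d e f ∧
      (∀ x y z : Fin 4 → ℝ, altForm a b c d e f (A.bracket x y) z +
        altForm a b c d e f (A.bracket y z) x + altForm a b c d e f (A.bracket z x) y = 0) ∧
      a * f - b * e + c * d ≠ 0 ∧
      ∀ x y : Fin 4 → ℝ, altForm a b c d e f (j x) (j y) = altForm a b c d e f x y := by
  obtain rfl : j = J := (funext hJ).symm
  constructor
  · rintro ⟨⟨halt, hcl, hnd⟩, hinv⟩
    have hω := A.eq_form_of_alternating ω halt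
    refine ⟨_, _, _, _, _, _, hω, fun x y z => ?_,
      (altForm_nondegenerate_iff _ _ _ _ _ _).1 fun x hx => hnd x fun y => ?_, fun x y => ?_⟩
    · have := hcl x y z
      rw [hω] at this
      exact this
    · rw [hω]
      exact hx y
    · have := hinv x y
      rw [hω] at this
      exact this
  · rintro ⟨a, b, c, d, e, f, rfl, hcl, hp, hinv⟩
    refine ⟨⟨fun x => ?_, fun x y z => hcl x y z,
      fun x hx => (altForm_nondegenerate_iff _ _ _ _ _ _).2 hp x hx⟩, fun x y => ?_⟩
    · rw [LieName.form_apply]; simp only [altForm]; ring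
    · exact hinv x y

theorem isComplexStructure_iff {A : LieName} {J : A.Alg →ₗ[ℝ] A.Alg}
    (j : (Fin 4 → ℝ) → Fin 4 → ℝ) (hJ : ∀ x, J x = j x) :
    IsComplexStructure J ↔ (∀ x, j (j x) = -x) ∧ ∀ x y,
      A.bracket (j x) (j y) - A.bracket x y - j (A.bracket (j x) y) - j (A.bracket x (j y)) = 0 := by
  obtain rfl : j = J := (funext hJ).symm
  rfl

namespace LieName

variable (A : LieName)

theorem neg_apply (x : A.Alg) (i : Fin 4) : (-x) i = -(x i) := rfl

theorem sub_apply (x y : A.Alg) (i : Fin 4) : (x - y) i = x i - y i := rfl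

theorem smul_apply (t : ℝ) (x : A.Alg) (i : Fin 4) : (t • x) i = t * x i := rfl

theorem e_apply (i j : Fin 4) : A.e i j = if j = i then 1 else 0 := by
  rw [e_eq_single, Pi.single_apply]

end LieName

/-- To compute the compatible symplectic structures it suffices to evaluate the equations on
basis vectors. -/
theorem kahler_entry {A : LieName} {J : A.Alg →ₗ[ℝ] A.Alg}
    {S : Set (LinearMap.BilinForm ℝ A.Alg)} (j : (Fin 4 → ℝ) → Fin 4 → ℝ) (hJ : ∀ x, J x = j x)
    (hjj : ∀ x, j (j x) = -x) (hN : ∀ x y,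
      A.bracket (j x) (j y) - A.bracket x y - j (A.bracket (j x) y) - j (A.bracket x (j y)) = 0)
    (hS : ∀ ω ∈ S, ∃ a b c d e f : ℝ, ω = A.form a b c d e f ∧
      (∀ x y z : Fin 4 → ℝ, altForm a b c d e f (A.bracket x y) z +
        altForm a b c d e f (A.bracket y z) x + altForm a b c d e f (A.bracket z x) y = 0) ∧
      a * f - b * e + c * d ≠ 0 ∧
      ∀ x y : Fin 4 → ℝ, altForm a b c d e f (j x) (j y) = altForm a b c d e f x y)
    (h : ∀ a b c d e f : ℝ,
      let F := altForm a b c d e f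
      let dF := fun x y z : Fin 4 → ℝ =>
        F (A.bracket x y) z + F (A.bracket y z) x + F (A.bracket z x) y
      let e₁ : Fin 4 → ℝ := ![1, 0, 0, 0]
      let e₂ : Fin 4 → ℝ := ![0, 1, 0, 0]
      let e₃ : Fin 4 → ℝ := ![0, 0, 1, 0]
      let e₄ : Fin 4 → ℝ := ![0, 0, 0, 1]
      dF e₁ e₂ e₃ = 0 → dF e₁ e₂ e₄ = 0 → dF e₁ e₃ e₄ = 0 → dF e₂ e₃ e₄ = 0 →
      F (j e₁) (j e₂) = F e₁ e₂ → F (j e₁) (j e₃) = F e₁ e₃ → F (j e₁) (j e₄) = F e₁ e₄ →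
      F (j e₂) (j e₃) = F e₂ e₃ → F (j e₂) (j e₄) = F e₂ e₄ → F (j e₃) (j e₄) = F e₃ e₄ →
      a * f - b * e + c * d ≠ 0 → A.form a b c d e f ∈ S) :
    IsComplexStructure J ∧ compatibleSymplectic J = S := by
  refine ⟨(isComplexStructure_iff j hJ).2 ⟨hjj, hN⟩, ?_⟩
  ext ω
  rw [mem_compatibleSymplectic_iff j hJ]
  refine ⟨?_, hS ω⟩
  rintro ⟨a, b, c, d, e, f, rfl, hcl, hp, hinv⟩
  exact h a b c d e f (hcl _ _ _) (hcl _ _ _) (hcl _ _ _) (hcl _ _ _) (hinv _ _) (hinv _ _)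
    (hinv _ _) (hinv _ _) (hinv _ _) (hinv _ _) hp

-- For each line of the table, closedness on basis triples and invariance on basis pairs are linear
-- in the six coefficients and leave exactly the listed family. On that family the Pfaffian is, up
-- to a nonzero factor, the quantity required to be nonzero or its square.
set_option maxHeartbeats 4000000 in
theorem KahlerTable.isComplexStructure_and_compatibleSymplectic_eq {A : LieName}
    {J : A.Alg →ₗ[ℝ] A.Alg} {S : Set (LinearMap.BilinForm ℝ A.Alg)} (h : KahlerTable A J S) :
    IsComplexStructure J ∧ compatibleSymplectic J = S := by
  cases h
  case rh3 =>
    refine kahler_entry (fun x => ![-x 1, x 0, -x 3, x 2]) (fun x => ?_) (fun x => ?_) (fun x y => ?_) ?_ ?_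
    · funext i; rw [endo_apply]; fin_cases i <;> simp [LieName.neg_apply, e_apply, mul_comm]
    · funext i; fin_cases i <;> simp
    · funext i; fin_cases i <;> simp [bracket] <;> ring
    · rintro ω ⟨a, b, c, h, rfl⟩
      refine ⟨c, a, b, -b, a, 0, by rw [form]; module, fun x y z => ?_, ?_, fun x y => ?_⟩
      · simp [altForm, bracket]; try ring
      · contrapose! h; linarith
      · simp [altForm]; try ring
    · intro a b c d e f F dF e₁ e₂ e₃ e₄ c1 c2 c3 c4 i1 i2 i3 i4 i5 i6 hp
      simp [F, dF, e₁, e₂, e₃, e₄, altForm, bracket] at c1 c2 c3 c4 i1 i2 i3 i4 i5 i6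
      obtain rfl : -c = d := by linarith
      obtain rfl : b = e := by linarith
      obtain rfl : 0 = f := by linarith
      refine ⟨b, c, a, ?_, by rw [form]; module⟩
      contrapose! hp; linear_combination (-1) * hp
  case rr30 =>
    refine kahler_entry (fun x => ![-x 1, x 0, -x 3, x 2]) (fun x => ?_) (fun x => ?_) (fun x y => ?_) ?_ ?_
    · funext i; rw [endo_apply]; fin_cases i <;> simp [LieName.neg_apply, e_apply, mul_comm]
    · funext i; fin_cases i <;> simp
    · funext i; fin_cases i <;> simp [bracket] <;> ring
    · rintro ω ⟨a, b, h, rfl⟩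
      refine ⟨a, 0, 0, 0, 0, b, by rw [form]; module, fun x y z => ?_, ?_, fun x y => ?_⟩
      · simp [altForm, bracket]; try ring
      · contrapose! h; linarith
      · simp [altForm]; try ring
    · intro a b c d e f F dF e₁ e₂ e₃ e₄ c1 c2 c3 c4 i1 i2 i3 i4 i5 i6 hp
      simp [F, dF, e₁, e₂, e₃, e₄, altForm, bracket] at c1 c2 c3 c4 i1 i2 i3 i4 i5 i6
      obtain rfl : 0 = d := by linarith
      obtain rfl : 0 = e := by linarith
      obtain rfl : 0 = b := by linarith
      obtain rfl : 0 = c := by linarith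
      refine ⟨a, f, ?_, by rw [form]; module⟩
      contrapose! hp; linear_combination hp
  case rr30' =>
    refine kahler_entry (fun x => ![-x 3, -x 2, x 1, x 0]) (fun x => ?_) (fun x => ?_) (fun x y => ?_) ?_ ?_
    · funext i; rw [endo_apply]; fin_cases i <;> simp [LieName.neg_apply, e_apply, mul_comm]
    · funext i; fin_cases i <;> simp
    · funext i; fin_cases i <;> simp [bracket] <;> ring
    · rintro ω ⟨a, b, h, rfl⟩
      refine ⟨0, 0, a, b, 0, 0, by rw [form]; module, fun x y z => ?_, ?_, fun x y => ?_⟩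
      · simp [altForm, bracket]; try ring
      · contrapose! h; linarith
      · simp [altForm]; try ring
    · intro a b c d e f F dF e₁ e₂ e₃ e₄ c1 c2 c3 c4 i1 i2 i3 i4 i5 i6 hp
      simp [F, dF, e₁, e₂, e₃, e₄, altForm, bracket] at c1 c2 c3 c4 i1 i2 i3 i4 i5 i6
      obtain rfl : 0 = e := by linarith
      obtain rfl : 0 = f := by linarith
      obtain rfl : 0 = a := by linarith
      obtain rfl : 0 = b := by linarith
      refine ⟨c, d, ?_, by rw [form]; module⟩
      contrapose! hp; linear_combination hp
  case r2r2 =>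
    refine kahler_entry (fun x => ![-x 1, x 0, -x 3, x 2]) (fun x => ?_) (fun x => ?_) (fun x y => ?_) ?_ ?_
    · funext i; rw [endo_apply]; fin_cases i <;> simp [LieName.neg_apply, e_apply, mul_comm]
    · funext i; fin_cases i <;> simp
    · funext i; fin_cases i <;> simp [bracket] <;> ring
    · rintro ω ⟨a, b, h, rfl⟩
      refine ⟨a, 0, 0, 0, 0, b, by rw [form]; module, fun x y z => ?_, ?_, fun x y => ?_⟩
      · simp [altForm, bracket]; try ring
      · contrapose! h; linarith
      · simp [altForm]; try ring
    · intro a b c d e f F dF e₁ e₂ e₃ e₄ c1 c2 c3 c4 i1 i2 i3 i4 i5 i6 hp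
      simp [F, dF, e₁, e₂, e₃, e₄, altForm, bracket] at c1 c2 c3 c4 i1 i2 i3 i4 i5 i6
      obtain rfl : 0 = d := by linarith
      obtain rfl : 0 = e := by linarith
      obtain rfl : 0 = c := by linarith
      obtain rfl : 0 = b := by linarith
      refine ⟨a, f, ?_, by rw [form]; module⟩
      contrapose! hp; linear_combination hp
  case r2'_J1 =>
    refine kahler_entry (fun x => ![-x 2, -x 3, x 0, x 1]) (fun x => ?_) (fun x => ?_) (fun x y => ?_) ?_ ?_
    · funext i; rw [endo_apply]; fin_cases i <;> simp [LieName.neg_apply, e_apply, mul_comm]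
    · funext i; fin_cases i <;> simp
    · funext i; fin_cases i <;> simp [bracket] <;> ring
    · rintro ω ⟨a, b, h, rfl⟩
      refine ⟨0, a, b, b, -a, 0, by rw [form]; module, fun x y z => ?_, ?_, fun x y => ?_⟩
      · simp [altForm, bracket]; try ring
      · contrapose! h; linarith
      · simp [altForm]; try ring
    · intro a b c d e f F dF e₁ e₂ e₃ e₄ c1 c2 c3 c4 i1 i2 i3 i4 i5 i6 hp
      simp [F, dF, e₁, e₂, e₃, e₄, altForm, bracket] at c1 c2 c3 c4 i1 i2 i3 i4 i5 i6
      obtain rfl : 0 = f := by linarith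
      obtain rfl : 0 = a := by linarith
      obtain rfl : c = d := by linarith
      obtain rfl : -b = e := by linarith
      refine ⟨b, c, ?_, by rw [form]; module⟩
      contrapose! hp; linear_combination hp
  case r2'_J2 =>
    refine kahler_entry (fun x => ![x 1, -x 0, -x 3, x 2]) (fun x => ?_) (fun x => ?_) (fun x y => ?_) ?_ ?_
    · funext i; rw [endo_apply]; fin_cases i <;> simp [LieName.neg_apply, e_apply, mul_comm]
    · funext i; fin_cases i <;> simp
    · funext i; fin_cases i <;> simp [bracket] <;> ring
    · rintro ω ⟨a, b, c, h, rfl⟩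
      refine ⟨c, a, b, b, -a, 0, by rw [form]; module, fun x y z => ?_, ?_, fun x y => ?_⟩
      · simp [altForm, bracket]; try ring
      · contrapose! h; linarith
      · simp [altForm]; try ring
    · intro a b c d e f F dF e₁ e₂ e₃ e₄ c1 c2 c3 c4 i1 i2 i3 i4 i5 i6 hp
      simp [F, dF, e₁, e₂, e₃, e₄, altForm, bracket] at c1 c2 c3 c4 i1 i2 i3 i4 i5 i6
      obtain rfl : 0 = f := by linarith
      obtain rfl : c = d := by linarith
      obtain rfl : -b = e := by linarith
      refine ⟨b, c, a, ?_, by rw [form]; module⟩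
      contrapose! hp; linear_combination hp
  case r4 =>
    refine kahler_entry (fun x => ![x 3, -x 2, x 1, -x 0]) (fun x => ?_) (fun x => ?_) (fun x y => ?_) ?_ ?_
    · funext i; rw [endo_apply]; fin_cases i <;> simp [LieName.neg_apply, e_apply, mul_comm]
    · funext i; fin_cases i <;> simp
    · funext i; fin_cases i <;> simp [bracket] <;> ring
    · rintro ω ⟨a, b, c, h, rfl⟩
      refine ⟨a, b, c, 0, -b, a, by rw [form]; module, fun x y z => ?_, ?_, fun x y => ?_⟩
      · simp [altForm, bracket]; try ring
      · contrapose! h; linarith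
      · simp [altForm]; try ring
    · intro a b c d e f F dF e₁ e₂ e₃ e₄ c1 c2 c3 c4 i1 i2 i3 i4 i5 i6 hp
      simp [F, dF, e₁, e₂, e₃, e₄, altForm, bracket] at c1 c2 c3 c4 i1 i2 i3 i4 i5 i6
      obtain rfl : 0 = d := by linarith
      obtain rfl : a = f := by linarith
      obtain rfl : -b = e := by linarith
      refine ⟨a, b, c, ?_, by rw [form]; module⟩
      contrapose! hp; linear_combination hp
  case r4'_J1 δ hδ =>
    refine kahler_entry (fun x => ![x 3, -x 2, x 1, -x 0]) (fun x => ?_) (fun x => ?_) (fun x y => ?_) ?_ ?_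
    · funext i; rw [endo_apply]; fin_cases i <;> simp [LieName.neg_apply, e_apply, mul_comm]
    · funext i; fin_cases i <;> simp
    · funext i; fin_cases i <;> simp [bracket] <;> ring
    · rintro ω ⟨a, b, h, rfl⟩
      refine ⟨0, 0, a, b, 0, 0, by rw [form]; module, fun x y z => ?_, ?_, fun x y => ?_⟩
      · simp [altForm, bracket]; try ring
      · contrapose! h; linarith
      · simp [altForm]; try ring
    · intro a b c d e f F dF e₁ e₂ e₃ e₄ c1 c2 c3 c4 i1 i2 i3 i4 i5 i6 hp
      simp [F, dF, e₁, e₂, e₃, e₄, altForm, bracket] at c1 c2 c3 c4 i1 i2 i3 i4 i5 i6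
      -- Closedness couples `a` and `b` through a 2×2 system of determinant 1 + δ².
      have hb : b * (δ ^ 2 + 1) = 0 := by linear_combination c3 - δ * c2
      obtain rfl : 0 = b := ((mul_eq_zero.1 hb).resolve_right (by positivity)).symm
      obtain rfl : 0 = a := by linarith
      obtain rfl : 0 = e := by linarith
      obtain rfl : 0 = f := by linarith
      refine ⟨c, d, ?_, by rw [form]; module⟩
      contrapose! hp; linear_combination hp
  case r4'_J2 δ hδ =>
    refine kahler_entry (fun x => ![x 3, x 2, -x 1, -x 0]) (fun x => ?_) (fun x => ?_) (fun x y => ?_) ?_ ?_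
    · funext i; rw [endo_apply]; fin_cases i <;> simp [LieName.neg_apply, e_apply, mul_comm]
    · funext i; fin_cases i <;> simp
    · funext i; fin_cases i <;> simp [bracket] <;> ring
    · rintro ω ⟨a, b, h, rfl⟩
      refine ⟨0, 0, a, b, 0, 0, by rw [form]; module, fun x y z => ?_, ?_, fun x y => ?_⟩
      · simp [altForm, bracket]; try ring
      · contrapose! h; linarith
      · simp [altForm]; try ring
    · intro a b c d e f F dF e₁ e₂ e₃ e₄ c1 c2 c3 c4 i1 i2 i3 i4 i5 i6 hp
      simp [F, dF, e₁, e₂, e₃, e₄, altForm, bracket] at c1 c2 c3 c4 i1 i2 i3 i4 i5 i6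
      have hb : b * (δ ^ 2 + 1) = 0 := by linear_combination c3 - δ * c2
      obtain rfl : 0 = b := ((mul_eq_zero.1 hb).resolve_right (by positivity)).symm
      obtain rfl : 0 = a := by linarith
      obtain rfl : 0 = e := by linarith
      obtain rfl : 0 = f := by linarith
      refine ⟨c, d, ?_, by rw [form]; module⟩
      contrapose! hp; linear_combination hp
  case d41 =>
    refine kahler_entry (fun x => ![-x 3, -x 2, x 1, x 0]) (fun x => ?_) (fun x => ?_) (fun x y => ?_) ?_ ?_
    · funext i; rw [endo_apply]; fin_cases i <;> simp [LieName.neg_apply, e_apply, mul_comm]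
    · funext i; fin_cases i <;> simp
    · funext i; fin_cases i <;> simp [bracket] <;> ring
    · rintro ω ⟨a, b, h, rfl⟩
      refine ⟨a, 0, b, 0, 0, -a, by rw [form]; module, fun x y z => ?_, ?_, fun x y => ?_⟩
      · simp [altForm, bracket]; try ring
      · contrapose! h; simpa using h
      · simp [altForm]; try ring
    · intro a b c d e f F dF e₁ e₂ e₃ e₄ c1 c2 c3 c4 i1 i2 i3 i4 i5 i6 hp
      simp [F, dF, e₁, e₂, e₃, e₄, altForm, bracket] at c1 c2 c3 c4 i1 i2 i3 i4 i5 i6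
      obtain rfl : -a = f := by linarith
      obtain rfl : 0 = b := by linarith
      obtain rfl : 0 = d := by linarith
      obtain rfl : 0 = e := by linarith
      refine ⟨a, c, ?_, by rw [form]; module⟩
      contrapose! hp; linear_combination (-a) * hp
  case d42_J1 =>
    refine kahler_entry (fun x => ![-x 2, -x 3, x 0, x 1]) (fun x => ?_) (fun x => ?_) (fun x y => ?_) ?_ ?_
    · funext i; rw [endo_apply]; fin_cases i <;> simp [LieName.neg_apply, e_apply, mul_comm]
    · funext i; fin_cases i <;> simp
    · funext i; fin_cases i <;> simp [bracket] <;> ring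
    · rintro ω ⟨a, b, h, rfl⟩
      refine ⟨0, 0, a, a, b, 0, by rw [form]; module, fun x y z => ?_, ?_, fun x y => ?_⟩
      · simp [altForm, bracket]; try ring
      · contrapose! h; simpa using h
      · simp [altForm]; try ring
    · intro a b c d e f F dF e₁ e₂ e₃ e₄ c1 c2 c3 c4 i1 i2 i3 i4 i5 i6 hp
      simp [F, dF, e₁, e₂, e₃, e₄, altForm, bracket] at c1 c2 c3 c4 i1 i2 i3 i4 i5 i6
      obtain rfl : 0 = a := by linarith
      obtain rfl : 0 = b := by linarith
      obtain rfl : 0 = f := by linarith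
      obtain rfl : c = d := by linarith
      refine ⟨c, e, ?_, by rw [form]; module⟩
      contrapose! hp; linear_combination (c) * hp
  case d42_J2 =>
    refine kahler_entry (fun x => ![-2 * x 3, -x 2, x 1, 1 / 2 * x 0]) (fun x => ?_) (fun x => ?_) (fun x y => ?_) ?_ ?_
    · funext i; rw [endo_apply]; fin_cases i <;> simp [LieName.neg_apply, LieName.smul_apply, e_apply, mul_comm]
    · funext i; fin_cases i <;> simp
    · funext i; fin_cases i <;> simp [bracket] <;> ring
    · rintro ω ⟨a, b, h, rfl⟩
      refine ⟨0, 0, a, b, 0, 0, by rw [form]; module, fun x y z => ?_, ?_, fun x y => ?_⟩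
      · simp [altForm, bracket]; try ring
      · contrapose! h; linarith
      · simp [altForm]; try ring
    · intro a b c d e f F dF e₁ e₂ e₃ e₄ c1 c2 c3 c4 i1 i2 i3 i4 i5 i6 hp
      simp [F, dF, e₁, e₂, e₃, e₄, altForm, bracket] at c1 c2 c3 c4 i1 i2 i3 i4 i5 i6
      obtain rfl : 0 = a := by linarith
      obtain rfl : 0 = b := by linarith
      obtain rfl : 0 = e := by linarith
      obtain rfl : 0 = f := by linarith
      refine ⟨c, d, ?_, by rw [form]; module⟩
      contrapose! hp; linear_combination hp
  case d4half_J1 =>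
    refine kahler_entry (fun x => ![-x 1, x 0, x 3, -x 2]) (fun x => ?_) (fun x => ?_) (fun x y => ?_) ?_ ?_
    · funext i; rw [endo_apply]; fin_cases i <;> simp [LieName.neg_apply, e_apply, mul_comm]
    · funext i; fin_cases i <;> simp
    · funext i; fin_cases i <;> simp [bracket] <;> ring
    · rintro ω ⟨a, h, rfl⟩
      refine ⟨a, 0, 0, 0, 0, -a, by rw [form]; module, fun x y z => ?_, ?_, fun x y => ?_⟩
      · simp [altForm, bracket]; try ring
      · contrapose! h; simpa using h
      · simp [altForm]; try ring
    · intro a b c d e f F dF e₁ e₂ e₃ e₄ c1 c2 c3 c4 i1 i2 i3 i4 i5 i6 hp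
      simp [F, dF, e₁, e₂, e₃, e₄, altForm, bracket] at c1 c2 c3 c4 i1 i2 i3 i4 i5 i6
      obtain rfl : -a = f := by linarith
      obtain rfl : 0 = b := by linarith
      obtain rfl : 0 = c := by linarith
      obtain rfl : 0 = d := by linarith
      obtain rfl : 0 = e := by linarith
      refine ⟨a, ?_, by rw [form]; module⟩
      contrapose! hp; linear_combination (-a) * hp
  case d4half_J2 =>
    refine kahler_entry (fun x => ![x 1, -x 0, x 3, -x 2]) (fun x => ?_) (fun x => ?_) (fun x y => ?_) ?_ ?_
    · funext i; rw [endo_apply]; fin_cases i <;> simp [LieName.neg_apply, e_apply, mul_comm]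
    · funext i; fin_cases i <;> simp
    · funext i; fin_cases i <;> simp [bracket] <;> ring
    · rintro ω ⟨a, h, rfl⟩
      refine ⟨a, 0, 0, 0, 0, -a, by rw [form]; module, fun x y z => ?_, ?_, fun x y => ?_⟩
      · simp [altForm, bracket]; try ring
      · contrapose! h; simpa using h
      · simp [altForm]; try ring
    · intro a b c d e f F dF e₁ e₂ e₃ e₄ c1 c2 c3 c4 i1 i2 i3 i4 i5 i6 hp
      simp [F, dF, e₁, e₂, e₃, e₄, altForm, bracket] at c1 c2 c3 c4 i1 i2 i3 i4 i5 i6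
      obtain rfl : -a = f := by linarith
      obtain rfl : 0 = b := by linarith
      obtain rfl : 0 = c := by linarith
      obtain rfl : 0 = d := by linarith
      obtain rfl : 0 = e := by linarith
      refine ⟨a, ?_, by rw [form]; module⟩
      contrapose! hp; linear_combination (-a) * hp
  case d4'_J1 δ hδ =>
    refine kahler_entry (fun x => ![-x 1, x 0, x 3, -x 2]) (fun x => ?_) (fun x => ?_) (fun x y => ?_) ?_ ?_
    · funext i; rw [endo_apply]; fin_cases i <;> simp [LieName.neg_apply, e_apply, mul_comm]
    · funext i; fin_cases i <;> simp
    · funext i; fin_cases i <;> simp [bracket] <;> ring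
    · rintro ω ⟨a, h, rfl⟩
      refine ⟨a, 0, 0, 0, 0, -δ * a, by rw [form]; module, fun x y z => ?_, ?_, fun x y => ?_⟩
      · simp [altForm, bracket]; try ring
      · contrapose! h; simpa [hδ.ne'] using h
      · simp [altForm]; try ring
    · intro a b c d e f F dF e₁ e₂ e₃ e₄ c1 c2 c3 c4 i1 i2 i3 i4 i5 i6 hp
      simp [F, dF, e₁, e₂, e₃, e₄, altForm, bracket] at c1 c2 c3 c4 i1 i2 i3 i4 i5 i6
      -- Here the coupled coefficients are `b` and `d`: the rotation by e₄ mixes e₁ and e₂, and 3/2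
      -- δ = δ/2 + δ is the sum of the real parts of the weights.
      have hb : b * (1 + 9 / 4 * δ ^ 2) = 0 := by linear_combination c4 + 3 / 2 * δ * c3
      obtain rfl : 0 = b := ((mul_eq_zero.1 hb).resolve_right (by positivity)).symm
      obtain rfl : -δ * a = f := by linarith
      obtain rfl : 0 = d := by linarith
      obtain rfl : 0 = c := by linarith
      obtain rfl : 0 = e := by linarith
      refine ⟨a, ?_, by rw [form]; module⟩
      contrapose! hp; linear_combination (-δ * a) * hp
  case d4'_J2 δ hδ =>
    refine kahler_entry (fun x => ![-x 1, x 0, -x 3, x 2]) (fun x => ?_) (fun x => ?_) (fun x y => ?_) ?_ ?_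
    · funext i; rw [endo_apply]; fin_cases i <;> simp [LieName.neg_apply, e_apply, mul_comm]
    · funext i; fin_cases i <;> simp
    · funext i; fin_cases i <;> simp [bracket] <;> ring
    · rintro ω ⟨a, h, rfl⟩
      refine ⟨a, 0, 0, 0, 0, -δ * a, by rw [form]; module, fun x y z => ?_, ?_, fun x y => ?_⟩
      · simp [altForm, bracket]; try ring
      · contrapose! h; simpa [hδ.ne'] using h
      · simp [altForm]; try ring
    · intro a b c d e f F dF e₁ e₂ e₃ e₄ c1 c2 c3 c4 i1 i2 i3 i4 i5 i6 hp
      simp [F, dF, e₁, e₂, e₃, e₄, altForm, bracket] at c1 c2 c3 c4 i1 i2 i3 i4 i5 i6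
      have hb : b * (1 + 9 / 4 * δ ^ 2) = 0 := by linear_combination c4 + 3 / 2 * δ * c3
      obtain rfl : 0 = b := ((mul_eq_zero.1 hb).resolve_right (by positivity)).symm
      obtain rfl : -δ * a = f := by linarith
      obtain rfl : 0 = d := by linarith
      obtain rfl : 0 = c := by linarith
      obtain rfl : 0 = e := by linarith
      refine ⟨a, ?_, by rw [form]; module⟩
      contrapose! hp; linear_combination (-δ * a) * hp
  case d4'_J3 δ hδ =>
    refine kahler_entry (fun x => ![x 1, -x 0, -x 3, x 2]) (fun x => ?_) (fun x => ?_) (fun x y => ?_) ?_ ?_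
    · funext i; rw [endo_apply]; fin_cases i <;> simp [LieName.neg_apply, e_apply, mul_comm]
    · funext i; fin_cases i <;> simp
    · funext i; fin_cases i <;> simp [bracket] <;> ring
    · rintro ω ⟨a, h, rfl⟩
      refine ⟨a, 0, 0, 0, 0, -δ * a, by rw [form]; module, fun x y z => ?_, ?_, fun x y => ?_⟩
      · simp [altForm, bracket]; try ring
      · contrapose! h; simpa [hδ.ne'] using h
      · simp [altForm]; try ring
    · intro a b c d e f F dF e₁ e₂ e₃ e₄ c1 c2 c3 c4 i1 i2 i3 i4 i5 i6 hp
      simp [F, dF, e₁, e₂, e₃, e₄, altForm, bracket] at c1 c2 c3 c4 i1 i2 i3 i4 i5 i6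
      have hb : b * (1 + 9 / 4 * δ ^ 2) = 0 := by linear_combination c4 + 3 / 2 * δ * c3
      obtain rfl : 0 = b := ((mul_eq_zero.1 hb).resolve_right (by positivity)).symm
      obtain rfl : -δ * a = f := by linarith
      obtain rfl : 0 = d := by linarith
      obtain rfl : 0 = c := by linarith
      obtain rfl : 0 = e := by linarith
      refine ⟨a, ?_, by rw [form]; module⟩
      contrapose! hp; linear_combination (-δ * a) * hp
  case d4'_J4 δ hδ =>
    refine kahler_entry (fun x => ![x 1, -x 0, x 3, -x 2]) (fun x => ?_) (fun x => ?_) (fun x y => ?_) ?_ ?_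
    · funext i; rw [endo_apply]; fin_cases i <;> simp [LieName.neg_apply, e_apply, mul_comm]
    · funext i; fin_cases i <;> simp
    · funext i; fin_cases i <;> simp [bracket] <;> ring
    · rintro ω ⟨a, h, rfl⟩
      refine ⟨a, 0, 0, 0, 0, -δ * a, by rw [form]; module, fun x y z => ?_, ?_, fun x y => ?_⟩
      · simp [altForm, bracket]; try ring
      · contrapose! h; simpa [hδ.ne'] using h
      · simp [altForm]; try ring
    · intro a b c d e f F dF e₁ e₂ e₃ e₄ c1 c2 c3 c4 i1 i2 i3 i4 i5 i6 hp
      simp [F, dF, e₁, e₂, e₃, e₄, altForm, bracket] at c1 c2 c3 c4 i1 i2 i3 i4 i5 i6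
      have hb : b * (1 + 9 / 4 * δ ^ 2) = 0 := by linear_combination c4 + 3 / 2 * δ * c3
      obtain rfl : 0 = b := ((mul_eq_zero.1 hb).resolve_right (by positivity)).symm
      obtain rfl : -δ * a = f := by linarith
      obtain rfl : 0 = d := by linarith
      obtain rfl : 0 = c := by linarith
      obtain rfl : 0 = e := by linarith
      refine ⟨a, ?_, by rw [form]; module⟩
      contrapose! hp; linear_combination (-δ * a) * hp

/-! ### Traces of powers of ad separate the algebras of the table -/

section TraceInvariants

/-- The trace of `(ad x) ^ k`. -/
noncomputable def adTrace {g : Type*} [LieRing g] [LieAlgebra ℝ g] (k : ℕ) (x : g) : ℝ :=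
  LinearMap.trace ℝ g ((LieAlgebra.ad ℝ g x) ^ k)

theorem adTrace_equiv {g h : Type*} [LieRing g] [LieAlgebra ℝ g] [LieRing h] [LieAlgebra ℝ h]
    (φ : g ≃ₗ⁅ℝ⁆ h) (k : ℕ) (x : g) : adTrace k (φ x) = adTrace k x := by
  rw [adTrace, adTrace, ← LieAlgebra.conj_ad_apply]
  have : (φ.toLinearEquiv.conj (LieAlgebra.ad ℝ g x)) ^ k =
      φ.toLinearEquiv.conj ((LieAlgebra.ad ℝ g x) ^ k) :=
    (map_pow φ.toLinearEquiv.conjRingEquiv _ k).symm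
  rw [this, LinearMap.trace_conj']

theorem LieName.adTrace_eq_sum {A : LieName} (k : ℕ) (x : A.Alg) :
    adTrace k x = ∑ i, (A.bracket x)^[k] (Pi.single i 1) i := by
  rw [adTrace, LinearMap.trace_eq_matrix_trace ℝ A.basis, Matrix.trace]
  refine Finset.sum_congr rfl fun i _ => ?_
  rw [Matrix.diag_apply, LinearMap.toMatrix_apply, Module.End.pow_apply]
  change ((LieAlgebra.ad ℝ A.Alg x)^[k] (A.e i)) i = _
  rw [e_eq_single]
  rfl

/-- The possible shapes of the trace functions `x ↦ tr (ad x) ^ k`, for `k = 1, 2, 3`, on the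
algebras of the table. -/
inductive TraceType : Type
  | zero
  | imaginary
  | twoReal
  | complex
  | ratio (p q : ℝ)

/-- The meaning of a trace type. -/
def TraceType.Holds (g : Type*) [LieRing g] [LieAlgebra ℝ g] : TraceType → Prop
  | zero => ∀ x : g, adTrace 1 x = 0 ∧ adTrace 2 x = 0
  | imaginary => (∀ x : g, adTrace 1 x = 0) ∧ ∃ x : g, adTrace 2 x < 0
  | twoReal => (∃ x : g, adTrace 1 x = 1) ∧ (∃ x : g, adTrace 1 x = 0 ∧ 0 < adTrace 2 x) ∧
      ∀ x : g, adTrace 1 x = 0 → 0 ≤ adTrace 2 x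
  | complex => (∃ x : g, adTrace 1 x = 1) ∧ ∃ x : g, adTrace 1 x = 0 ∧ adTrace 2 x < 0
  | ratio p q => (∃ x : g, adTrace 1 x = 1) ∧
      ∀ x : g, adTrace 2 x = p * adTrace 1 x ^ 2 ∧ adTrace 3 x = q * adTrace 1 x ^ 3

theorem TraceType.Holds.congr {g h : Type*} [LieRing g] [LieAlgebra ℝ g] [LieRing h]
    [LieAlgebra ℝ h] (φ : g ≃ₗ⁅ℝ⁆ h) {t : TraceType} (ht : t.Holds g) : t.Holds h := by
  have hφ : ∀ k x, adTrace k (φ.toLieHom x) = adTrace k x := adTrace_equiv φ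
  cases t <;> simp only [TraceType.Holds, φ.surjective.forall, φ.surjective.exists, hφ] <;> exact ht

theorem TraceType.Holds.unique {g : Type*} [LieRing g] [LieAlgebra ℝ g] {s t : TraceType}
    (hs : s.Holds g) (ht : t.Holds g) : s = t := by
  -- The types exclude one another; for two ratios, an x with tr ad x = 1 reads off both constants.
  -- Ordering the constructors halves the number of cases.
  have key : ∀ {s t : TraceType}, s.Holds g → t.Holds g → s.ctorIdx ≤ t.ctorIdx → s = t := by
    intro s t hs ht hst
    cases s <;> cases t <;> simp [TraceType.ctorIdx] at hst <;>
      simp only [TraceType.Holds] at hs ht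
    case ratio.ratio p q p' q' =>
      obtain ⟨⟨x, hx⟩, h1⟩ := hs
      obtain ⟨-, h2⟩ := ht
      have h3 := h1 x
      have h4 := h2 x
      rw [h4.1, h4.2, hx] at h3
      simp at h3
      rw [h3.1, h3.2]
    all_goals first
      | rfl
      | (exfalso; grind)
  rcases le_total s.ctorIdx t.ctorIdx with h | h
  · exact key hs ht h
  · exact (key ht hs h).symm

/-- The trace types of the algebras of the table. -/
noncomputable def LieName.traceType : LieName → TraceType
  | rh3 => .zero
  | rr3 _ => .ratio 1 1
  | rr3' _ => .imaginary
  | r2r2 => .twoReal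
  | r2' => .complex
  | r4 _ _ => .ratio 3 1
  -- The constants come from the eigenvalues of ad e₄: 1, ±iδ here; 1, a, 1 - a for `d4 a`; δ, δ/2 ±
  -- i for `d4' δ`. Parameters written `_` have the value occurring in the table. The cubic ratio is
  -- needed: `r4' 0 (1 / 2)` and `d4 1` have the same quadratic ratio 1/2.
  | r4' _ δ => .ratio (1 - 2 * δ ^ 2) 1
  | d4 a => .ratio ((1 + a ^ 2 + (1 - a) ^ 2) / 4) ((1 + a ^ 3 + (1 - a) ^ 3) / 8)
  | d4' δ => .ratio (3 / 8 - 1 / (2 * δ ^ 2)) (5 / 32 - 3 / (8 * δ ^ 2))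

theorem KahlerTable.traceType_holds {A : LieName} {J : A.Alg →ₗ[ℝ] A.Alg}
    {S : Set (LinearMap.BilinForm ℝ A.Alg)} (h : KahlerTable A J S) : A.traceType.Holds A.Alg := by
  have d4_holds (a : ℝ) : (d4 a).traceType.Holds (d4 a).Alg := by
    refine ⟨⟨(1 / 2 : ℝ) • e _ 3, ?_⟩, fun x => ⟨?_, ?_⟩⟩ <;>
      simp [adTrace_eq_sum, Fin.sum_univ_four, bracket, LieName.smul_apply, e_apply] <;> ring
  have r4'_holds (δ : ℝ) : (r4' 0 δ).traceType.Holds (r4' 0 δ).Alg := by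
    refine ⟨⟨e _ 3, ?_⟩, fun x => ⟨?_, ?_⟩⟩ <;>
      simp [adTrace_eq_sum, Fin.sum_univ_four, bracket, e_apply] <;> ring
  have d4'_holds (δ : ℝ) (hδ : 0 < δ) : (d4' δ).traceType.Holds (d4' δ).Alg := by
    refine ⟨⟨(1 / (2 * δ) : ℝ) • e _ 3, ?_⟩, fun x => ⟨?_, ?_⟩⟩ <;>
      simp [adTrace_eq_sum, Fin.sum_univ_four, bracket, LieName.smul_apply, e_apply] <;> field_simp <;> ring
  cases h
  case rh3 =>
    intro x
    simp [adTrace_eq_sum, Fin.sum_univ_four, bracket]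
  case rr30 =>
    refine ⟨⟨e _ 0, ?_⟩, fun x => ⟨?_, ?_⟩⟩ <;>
      simp [adTrace_eq_sum, Fin.sum_univ_four, bracket, e_apply] <;> ring
  case rr30' =>
    refine ⟨fun x => ?_, e _ 0, ?_⟩ <;>
      simp [adTrace_eq_sum, Fin.sum_univ_four, bracket, e_apply]
  case r2r2 =>
    refine ⟨⟨e _ 0, ?_⟩, ⟨e _ 0 - e _ 2, ?_, ?_⟩, fun x hx => ?_⟩ <;>
      simp [adTrace_eq_sum, Fin.sum_univ_four, bracket, LieName.sub_apply, e_apply]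
    exact add_nonneg (mul_self_nonneg _) (mul_self_nonneg _)
  case r2'_J1 | r2'_J2 =>
    refine ⟨⟨(1 / 2 : ℝ) • e _ 0, ?_⟩, e _ 1, ?_, ?_⟩ <;>
      simp [adTrace_eq_sum, Fin.sum_univ_four, bracket, LieName.smul_apply, e_apply] <;> norm_num
  case r4 =>
    refine ⟨⟨-e _ 3, ?_⟩, fun x => ⟨?_, ?_⟩⟩ <;>
      simp [adTrace_eq_sum, Fin.sum_univ_four, bracket, LieName.neg_apply, e_apply] <;> ring
  case r4'_J1 δ _ | r4'_J2 δ _ => exact r4'_holds δ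
  case d41 | d42_J1 | d42_J2 | d4half_J1 | d4half_J2 => exact d4_holds _
  case d4'_J1 δ hδ | d4'_J2 δ hδ | d4'_J3 δ hδ | d4'_J4 δ hδ => exact d4'_holds δ hδ

/-- Isomorphic algebras of the table are equal. -/
theorem eq_of_equiv_of_kahlerTable {A A' : LieName} {J : A.Alg →ₗ[ℝ] A.Alg}
    {S : Set (LinearMap.BilinForm ℝ A.Alg)} {J' : A'.Alg →ₗ[ℝ] A'.Alg}
    {S' : Set (LinearMap.BilinForm ℝ A'.Alg)} (h : KahlerTable A J S) (h' : KahlerTable A' J' S')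
    (φ : A.Alg ≃ₗ⁅ℝ⁆ A'.Alg) : A = A' := by
  have key : A.traceType = A'.traceType := (h.traceType_holds.congr φ).unique h'.traceType_holds
  have hA : A = rh3 ∨ A = rr3 0 ∨ A = rr3' 0 ∨ A = r2r2 ∨ A = r2' ∨ A = r4 (-1) (-1) ∨
      (∃ δ, 0 < δ ∧ A = r4' 0 δ) ∨ A = d4 1 ∨ A = d4 2 ∨ A = d4 (1 / 2) ∨
      ∃ δ, 0 < δ ∧ A = d4' δ := by
    cases h <;> simp [*]
  have hA' : A' = rh3 ∨ A' = rr3 0 ∨ A' = rr3' 0 ∨ A' = r2r2 ∨ A' = r2' ∨ A' = r4 (-1) (-1) ∨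
      (∃ δ, 0 < δ ∧ A' = r4' 0 δ) ∨ A' = d4 1 ∨ A' = d4 2 ∨ A' = d4 (1 / 2) ∨
      ∃ δ, 0 < δ ∧ A' = d4' δ := by
    cases h' <;> simp [*]
  clear h h' φ
  have hpos : ∀ δ : ℝ, 0 < δ → 0 < δ ^ 2 ∧ 0 < (δ ^ 2)⁻¹ * 2⁻¹ ∧ 0 < 3 / (8 * δ ^ 2) :=
    fun δ hδ => ⟨by positivity, by positivity, by positivity⟩
  rcases hA with rfl | rfl | rfl | rfl | rfl | rfl | ⟨δ, hδ, rfl⟩ | rfl | rfl | rfl | ⟨δ, hδ, rfl⟩ <;>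
  rcases hA' with rfl | rfl | rfl | rfl | rfl | rfl | ⟨δ', hδ', rfl⟩ | rfl | rfl | rfl |
    ⟨δ', hδ', rfl⟩ <;>
  simp [traceType] at key <;>
  -- Within a family with parameter, the quadratic ratio is injective in δ² and δ > 0. The ratio of
  -- `d4' δ` is strictly below the value 3/8 of `d4 (1 / 2)`.
  first
  | rfl
  | rw [(pow_left_inj₀ hδ.le hδ'.le two_ne_zero).1 key]
  | rw [(pow_left_inj₀ hδ.le hδ'.le two_ne_zero).1 key.1]
  | (norm_num at key; done)
  | grind

end TraceInvariants

/-! ### Decomposition of the bracket by complex type -/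

section ComplexLie

open Complex ComplexConjugate

variable {V : Type*} [LieRing V] [LieAlgebra ℝ V] [Module ℂ V] [IsScalarTower ℝ ℂ V]

theorem complex_smul_eq {W : Type*} [AddCommGroup W] [Module ℝ W] [Module ℂ W]
    [IsScalarTower ℝ ℂ W] (c : ℂ) (x : W) : c • x = c.re • x + c.im • (I • x) := by
  conv_lhs => rw [← re_add_im c]
  rw [add_smul, mul_smul]
  exact congrArg₂ (· + ·) (algebraMap_smul ℂ c.re x) (algebraMap_smul ℂ c.im (I • x))

theorem map_complex_smul {W W' : Type*} [AddCommGroup W] [Module ℝ W] [Module ℂ W]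
    [IsScalarTower ℝ ℂ W] [AddCommGroup W'] [Module ℝ W'] [Module ℂ W'] [IsScalarTower ℝ ℂ W']
    (f : W →ₗ[ℝ] W') (hf : ∀ x, f (I • x) = I • f x) (c : ℂ) (x : W) : f (c • x) = c • f x := by
  rw [complex_smul_eq c x, complex_smul_eq c (f x), map_add, map_smul, map_smul, hf]

theorem map_conj_smul {W W' : Type*} [AddCommGroup W] [Module ℝ W] [Module ℂ W]
    [IsScalarTower ℝ ℂ W] [AddCommGroup W'] [Module ℝ W'] [Module ℂ W'] [IsScalarTower ℝ ℂ W']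
    (f : W →ₗ[ℝ] W') (hf : ∀ x, f (I • x) = -(I • f x)) (c : ℂ) (x : W) :
    f (c • x) = conj c • f x := by
  rw [complex_smul_eq c x, complex_smul_eq (conj c) (f x), map_add, map_smul, map_smul, hf, conj_re,
    conj_im, smul_neg, neg_smul]

theorem I_smul_I_smul {W : Type*} [AddCommGroup W] [Module ℂ W] (x : W) : I • I • x = -x := by
  rw [smul_smul, I_mul_I, neg_one_smul]

/-- A Lie bracket with integrable complex structure splits into a complex bilinear part `S` and
a part coming from a sesquilinear map `M`. -/
structure HolomorphicSplitting (V : Type*) [LieRing V] [LieAlgebra ℝ V] [Module ℂ V] where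
  /-- The complex bilinear part of the bracket. -/
  S : V →ₗ[ℂ] V →ₗ[ℂ] V
  /-- The sesquilinear map which gives the rest of the bracket. -/
  M : V →ₛₗ[starRingEnd ℂ] V →ₗ[ℂ] V
  S_self : ∀ x, S x x = 0
  lie_eq : ∀ x y, ⁅x, y⁆ = S x y + M x y - M y x

/-- The Nijenhuis expression is -4 times the component of the bracket conjugate-linear in both
arguments. Once this is zero, averaging over x ↦ Ix and y ↦ Iy isolates the complex bilinear part
`S` and the part `M` of mixed type. The splitting depends on the bracket alone, so one `D` serves
all ω. -/
theorem exists_holomorphicSplitting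
    (hN : ∀ x y : V, ⁅I • x, I • y⁆ - ⁅x, y⁆ - I • ⁅I • x, y⁆ - I • ⁅x, I • y⁆ = 0) :
    ∃ D : HolomorphicSplitting V, ∀ ω : LinearMap.BilinForm ℝ V, IsSymplecticStructure ω →
      (∀ x y, ω (I • x) (I • y) = ω x y) →
      ∀ x y z, ω (D.S x y) z = ω x (D.M y z) - ω y (D.M x z) := by
  have hN' : ∀ x y : V, I • ⁅I • x, y⁆ = ⁅I • x, I • y⁆ - ⁅x, y⁆ - I • ⁅x, I • y⁆ := fun x y => by
    linear_combination (norm := module) -hN x y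
  have comm : ∀ (r : ℝ) (x : V), I • r • x = r • I • x := fun r x => smul_comm _ _ _
  let s₀ : V →ₗ[ℝ] V →ₗ[ℝ] V := LinearMap.mk₂ ℝ
    (fun x y => (1 / 2 : ℝ) • (⁅x, y⁆ - ⁅I • x, I • y⁆))
    (by intros; simp only [smul_add, add_lie]; module)
    (by intros; simp only [smul_lie, comm]; module)
    (by intros; simp only [smul_add, lie_add]; module)
    (by intros; simp only [lie_smul, comm]; module)
  let m₀ : V →ₗ[ℝ] V →ₗ[ℝ] V := LinearMap.mk₂ ℝ
    (fun x y => (1 / 4 : ℝ) • (⁅x, y⁆ + ⁅I • x, I • y⁆ - I • ⁅x, I • y⁆ + I • ⁅I • x, y⁆))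
    (by intros; simp only [smul_add, add_lie]; module)
    (by intros; simp only [smul_add, smul_lie, comm, smul_sub]; module)
    (by intros; simp only [smul_add, lie_add]; module)
    (by intros; simp only [smul_add, lie_smul, comm, smul_sub]; module)
  have s_apply : ∀ x y, s₀ x y = (1 / 2 : ℝ) • (⁅x, y⁆ - ⁅I • x, I • y⁆) := fun _ _ => rfl
  have m_apply : ∀ x y, m₀ x y = (1 / 4 : ℝ) •
    (⁅x, y⁆ + ⁅I • x, I • y⁆ - I • ⁅x, I • y⁆ + I • ⁅I • x, y⁆) := fun _ _ => rfl
  have s1 : ∀ x y, s₀ (I • x) y = I • s₀ x y := fun x y => by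
    rw [s_apply, s_apply, comm]
    have := hN' x (I • y)
    simp only [I_smul_I_smul, lie_neg, neg_lie, smul_neg, smul_sub] at this ⊢
    rw [this]; module
  have s2 : ∀ x y, s₀ x (I • y) = I • s₀ x y := fun x y => by
    rw [s_apply, s_apply, comm]
    have := hN' x (I • y)
    simp only [I_smul_I_smul, lie_neg, smul_neg, smul_sub] at this ⊢
    rw [this]; module
  have m1 : ∀ x y, m₀ (I • x) y = -(I • m₀ x y) := fun x y => by
    rw [m_apply, m_apply, comm]
    simp only [I_smul_I_smul, smul_sub, smul_add, neg_lie, smul_neg]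
    abel
  have m2 : ∀ x y, m₀ x (I • y) = I • m₀ x y := fun x y => by
    rw [m_apply, m_apply, comm]
    simp only [I_smul_I_smul, smul_sub, smul_add, lie_neg, smul_neg]
    abel
  let s : V →ₗ[ℂ] V →ₗ[ℂ] V := LinearMap.mk₂ ℂ (fun x y => s₀ x y)
    (fun x y z => by rw [map_add, LinearMap.add_apply])
    (fun c x y => map_complex_smul (s₀.flip y) (fun x => s1 x y) c x)
    (fun x y z => map_add _ _ _)
    (fun c x y => map_complex_smul (s₀ x) (s2 x) c y)
  let m : V →ₛₗ[starRingEnd ℂ] V →ₗ[ℂ] V := LinearMap.mk₂'ₛₗ _ _ (fun x y => m₀ x y)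
    (fun x y z => by rw [map_add, LinearMap.add_apply])
    (fun c x y => map_conj_smul (m₀.flip y) (fun x => m1 x y) c x)
    (fun x y z => map_add _ _ _)
    (fun c x y => map_complex_smul (m₀ x) (m2 x) c y)
  have key : ∀ x y : V, ⁅x, y⁆ = s₀ x y + m₀ x y - m₀ y x := fun x y => by
    rw [s_apply, m_apply, m_apply, ← lie_skew x y, ← lie_skew (I • x) y, ← lie_skew x (I • y),
      ← lie_skew (I • x) (I • y)]
    simp only [smul_neg]
    module
  refine ⟨⟨s, m, fun x => ?_, key⟩, fun ω hω hinv x y z => ?_⟩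
  · change s₀ x x = 0
    rw [s_apply, lie_self, lie_self, sub_zero, smul_zero]
  · change ω (s₀ x y) z = ω x (m₀ y z) - ω y (m₀ x z)
    obtain ⟨halt, hcl, -⟩ := hω
    have skew : ∀ x y, ω x y = -ω y x := fun x y => by
      have := halt (x + y)
      simp only [map_add, LinearMap.add_apply, halt] at this
      linarith
    have hI : ∀ x y, ω x (I • y) = -ω (I • x) y := fun x y => by
      rw [← hinv x (I • y), I_smul_I_smul, map_neg]
    rw [s_apply, m_apply, m_apply]
    simp only [map_smul, map_sub, map_add, LinearMap.smul_apply, LinearMap.sub_apply, smul_eq_mul,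
      hI]
    have hcl' : ∀ x y z, ω ⁅x, y⁆ z = ω x ⁅y, z⁆ - ω y ⁅x, z⁆ := fun x y z => by
      have := hcl x y z
      rw [← lie_skew z x, skew _ x, skew _ y, map_neg] at this
      linear_combination this
    have c1 := hcl' x y z
    have c2 := hcl' (I • x) (I • y) z
    have c3 := hI ⁅I • x, y⁆ z ▸ hcl' (I • x) y (I • z)
    have c4 := hI ⁅x, I • y⁆ z ▸ hcl' x (I • y) (I • z)
    have n := congrArg (fun t => ω t z) (hN' x y)
    simp only [map_sub, LinearMap.sub_apply] at n
    -- Averaging closedness over (x,y,z), (Ix,Iy,z), (Ix,y,Iz), (x,Iy,Iz) extracts one type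
    -- component; `n` uses integrability.
    linear_combination (1 / 4 : ℝ) * (c1 - c2 + c3 + c4 + n)

end ComplexLie

/-! ### Components of the Jacobi identity -/

namespace HolomorphicSplitting

open Complex ComplexConjugate

variable {V : Type*} [LieRing V] [LieAlgebra ℝ V] [Module ℂ V] (D : HolomorphicSplitting V)

theorem S_skew (x y : V) : D.S x y = -D.S y x := by
  have h := D.S_self (x + y)
  simp only [map_add, LinearMap.add_apply, D.S_self, zero_add, add_zero] at h
  exact eq_neg_of_add_eq_zero_right h

/-- This is the component of the Jacobi identity conjugate-linear in `x` and `y`, extracted by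
averaging f ↦ (f + I f(I·))/2 in each variable. It is what makes the operators `M x` closed under
commutators. -/
theorem M_commutator (x y t : V) : D.M x (D.M y t) - D.M y (D.M x t) = D.M (D.S x y) t := by
  have f₁ := leibniz_lie x y t
  have f₂ := leibniz_lie (I • x) y t
  have f₃ := leibniz_lie x (I • y) t
  have f₄ := leibniz_lie (I • x) (I • y) t
  simp only [D.lie_eq, map_add, map_sub, LinearMap.add_apply, LinearMap.sub_apply, map_smulₛₗ,
    LinearMap.smul_apply, conj_I, neg_smul, smul_neg, RingHom.id_apply,
    LinearMap.neg_apply, map_neg, smul_add, smul_sub, I_smul_I_smul] at f₁ f₂ f₃ f₄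
  have g₂ := congrArg (I • ·) f₂
  have g₃ := congrArg (I • ·) f₃
  simp only [smul_add, smul_sub, smul_neg, I_smul_I_smul] at g₂ g₃
  linear_combination (norm := module) (1 / 4 : ℂ) • (f₁ + g₂ + g₃ - f₄)

/-- This is the component linear in `x` and `y` and conjugate-linear in `z`; the eight instances are
the projections in three variables. -/
theorem M_S (x y z : V) : D.M z (D.S x y) =
    D.S x (D.M z y) + D.S (D.M z x) y + D.M (D.M y z) x - D.M (D.M x z) y := by
  have f₁ := leibniz_lie x y z
  have f₂ := leibniz_lie (I • x) y z
  have f₃ := leibniz_lie x (I • y) z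
  have f₄ := leibniz_lie (I • x) (I • y) z
  have f₅ := leibniz_lie x y (I • z)
  have f₆ := leibniz_lie (I • x) y (I • z)
  have f₇ := leibniz_lie x (I • y) (I • z)
  have f₈ := leibniz_lie (I • x) (I • y) (I • z)
  simp only [D.lie_eq, map_add, map_sub, LinearMap.add_apply, LinearMap.sub_apply, map_smulₛₗ,
    LinearMap.smul_apply, conj_I, neg_smul, smul_neg, RingHom.id_apply,
    LinearMap.neg_apply, map_neg, smul_add, smul_sub, I_smul_I_smul] at f₁ f₂ f₃ f₄ f₅ f₆ f₇ f₈
  have g₂ := congrArg (I • ·) f₂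
  have g₃ := congrArg (I • ·) f₃
  have g₅ := congrArg (I • ·) f₅
  have g₈ := congrArg (I • ·) f₈
  simp only [smul_add, smul_sub, smul_neg, I_smul_I_smul] at g₂ g₃ g₅ g₈
  rw [D.S_skew (D.M z x) y]
  linear_combination (norm := module)
    (1 / 8 : ℂ) • (f₁ - g₂ - g₃ - f₄ + g₅ + f₆ + f₇ - g₈)

end HolomorphicSplitting

/-- Two endomorphisms of a complex plane which span a Lie algebra have a common eigenvector. -/
theorem exists_common_eigenvector {V : Type*} [AddCommGroup V] [Module ℂ V]
    (hV : Module.finrank ℂ V = 2) (A B : Module.End ℂ V) (α β : ℂ)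
    (h : A * B - B * A = α • A + β • B) :
    ∃ w ≠ 0, (∃ p : ℂ, A w = p • w) ∧ ∃ q : ℂ, B w = q • w := by
  have : FiniteDimensional ℂ V := Module.finite_of_finrank_eq_succ hV
  have : Nontrivial V := Module.nontrivial_of_finrank_eq_succ hV
  -- A nonzero singular `C` has a line as kernel; if `A` and `B` preserve it, it is spanned by a
  -- common eigenvector.
  have eig : ∀ C : Module.End ℂ V, (∀ w, C w = 0 → C (A w) = 0 ∧ C (B w) = 0) →
      C ≠ 0 → (∃ x ≠ 0, C x = 0) →
      ∃ w ≠ 0, (∃ p : ℂ, A w = p • w) ∧ ∃ q : ℂ, B w = q • w := by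
    rintro C hC hne ⟨x, hx, hCx⟩
    have h1 : Module.finrank ℂ (LinearMap.ker C) = 1 := by
      have h2 := LinearMap.finrank_range_add_finrank_ker C
      have h3 : Module.finrank ℂ (LinearMap.range C) ≠ 0 := by
        rw [Ne, Submodule.finrank_eq_zero, LinearMap.range_eq_bot]
        exact hne
      have h4 : Module.finrank ℂ (LinearMap.ker C) ≠ 0 := by
        rw [Ne, Submodule.finrank_eq_zero, Submodule.eq_bot_iff]
        exact fun hh => hx (hh x hCx)
      omega
    have h2 := (finrank_eq_one_iff_of_nonzero' (⟨x, hCx⟩ : LinearMap.ker C)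
      (fun hh => hx (congrArg Subtype.val hh))).1 h1
    refine ⟨x, hx, ?_, ?_⟩
    · obtain ⟨c, hc⟩ := h2 ⟨A x, (hC x hCx).1⟩
      exact ⟨c, (congrArg Subtype.val hc).symm⟩
    · obtain ⟨c, hc⟩ := h2 ⟨B x, (hC x hCx).2⟩
      exact ⟨c, (congrArg Subtype.val hc).symm⟩
  set C := α • A + β • B with hCdef
  -- If the commutator vanishes, either `A` is scalar or A - μ serves as the singular operator.
  -- Otherwise `C` itself serves, since [A,C] = βC and [B,C] = -αC preserve its kernel.
  by_cases hC : C = 0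
  · rw [hC] at h
    have hcomm : ∀ x, A (B x) = B (A x) := fun x => by
      have := LinearMap.congr_fun h x
      simpa [sub_eq_zero] using this
    obtain ⟨μ, hμ⟩ := Module.End.exists_eigenvalue A
    obtain ⟨x, hx⟩ := hμ.exists_hasEigenvector
    by_cases hA : A - μ • 1 = 0
    · obtain ⟨ν, hν⟩ := Module.End.exists_eigenvalue B
      obtain ⟨y, hy⟩ := hν.exists_hasEigenvector
      refine ⟨y, hy.2, ⟨μ, ?_⟩, ν, hy.apply_eq_smul⟩
      have := LinearMap.congr_fun hA y
      simpa [sub_eq_zero] using this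
    · refine eig (A - μ • 1) (fun w hw => ?_) hA ⟨x, hx.2, by simp [hx.apply_eq_smul]⟩
      have hw' : A w = μ • w := by simpa [sub_eq_zero] using hw
      simp [hcomm, hw']
  · have hAC : A * C - C * A = β • C := by
      conv_rhs => rw [← h]
      rw [hCdef]
      simp only [mul_add, add_mul, mul_smul_comm, smul_mul_assoc]
      module
    have hBC : B * C - C * B = (-α) • C := by
      conv_rhs => rw [← h]
      rw [hCdef]
      simp only [mul_add, add_mul, mul_smul_comm, smul_mul_assoc]
      module
    refine eig C (fun w hw => ⟨?_, ?_⟩) hC ?_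
    · have := LinearMap.congr_fun hAC w
      simpa [hw] using this
    · have := LinearMap.congr_fun hBC w
      simpa [hw] using this
    · by_contra hcon
      push Not at hcon
      have hu : IsUnit C := (LinearMap.isUnit_iff_ker_eq_bot C).2 <|
        (Submodule.eq_bot_iff _).2 fun x hx => by_contra fun hne => hcon x hne hx
      obtain ⟨D, hD, hD'⟩ := isUnit_iff_exists.1 hu
      -- If `C` were invertible, the trace of X - C X C⁻¹ = γ would give 2γ = 0, hence α = β = 0 and
      -- C = 0.
      have trace_zero : ∀ (X : Module.End ℂ V) (γ : ℂ), X * C - C * X = γ • C → γ = 0 := by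
        intro X γ hX
        have h1 := congrArg (fun Y => LinearMap.trace ℂ V (Y * D)) hX
        simp only [sub_mul, smul_mul_assoc, mul_assoc, hD, map_sub, map_smul, mul_one,
          LinearMap.trace_one, hV, LinearMap.trace_mul_comm ℂ C, hD'] at h1
        simpa using h1
      have h1 := trace_zero A β hAC
      have h2 := trace_zero B (-α) hBC
      exact hC (by rw [hCdef, h1, neg_eq_zero.1 h2, zero_smul, zero_smul, add_zero])

/-! ### Recognising the lines of the table from complex structure constants -/

section Identification

open Complex ComplexConjugate

/-- `V` with the complex structure `x ↦ I • x` is isomorphic to an entry of the table. -/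
def InKahlerTable (V : Type*) [LieRing V] [LieAlgebra ℝ V] [Module ℂ V] : Prop :=
  ∃ (A : LieName) (J₀ : A.Alg →ₗ[ℝ] A.Alg) (S : Set (LinearMap.BilinForm ℝ A.Alg))
    (φ : V ≃ₗ⁅ℝ⁆ A.Alg), KahlerTable A J₀ S ∧ ∀ x, φ (I • x) = J₀ (φ x)

variable {V : Type*} [LieRing V] [LieAlgebra ℝ V] [Module ℂ V] [IsScalarTower ℝ ℂ V]

theorem LieName.coord_sum {A : LieName} {W : Type*} [AddCommGroup W] [Module ℝ W]
    (ψ : A.Alg →ₗ[ℝ] W) (x : A.Alg) : ψ x = ∑ k, x k • ψ (A.e k) := by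
  conv_lhs => rw [← A.basis.sum_repr x]
  rw [map_sum]
  exact Finset.sum_congr rfl fun k _ => map_smul ψ _ _

theorem inKahlerTable_of_basis {A : LieName} {J₀ : A.Alg →ₗ[ℝ] A.Alg}
    {S : Set (LinearMap.BilinForm ℝ A.Alg)} (h : KahlerTable A J₀ S) (b : Module.Basis (Fin 4) ℝ V)
    (hJ : ∀ i, I • b i = ∑ k, (J₀ (A.e i)) k • b k)
    (hbr : ∀ i j, i < j → ⁅b i, b j⁆ = ∑ k, (⁅A.e i, A.e j⁆ : A.Alg) k • b k) :
    InKahlerTable V := by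
  let ψ : A.Alg ≃ₗ[ℝ] V := A.basis.equiv b (Equiv.refl _)
  have hψ : ∀ i, ψ (A.e i) = b i := fun i => by
    simp [ψ, e]
  have hψ' : ∀ x : A.Alg, ψ x = ∑ k, x k • b k := fun x => by
    simp only [← hψ]
    exact coord_sum ψ.toLinearMap x
  have hskew : ∀ i j, ⁅b i, b j⁆ = ψ ⁅A.e i, A.e j⁆ := fun i j => by
    rcases lt_trichotomy i j with hij | rfl | hij
    · rw [hψ', hbr i j hij]
    · rw [lie_self, lie_self, map_zero]
    · rw [← lie_skew, ← lie_skew (A.e i), map_neg, hψ', hbr j i hij]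
  have hlie : ∀ x y : A.Alg, ψ ⁅x, y⁆ = ⁅ψ x, ψ y⁆ := fun x y => by
    let B : A.Alg →ₗ[ℝ] A.Alg →ₗ[ℝ] V := LinearMap.mk₂ ℝ (fun x y => ψ ⁅x, y⁆ - ⁅ψ x, ψ y⁆)
      (by intros; simp only [add_lie, map_add]; abel)
      (by intros; simp only [smul_lie, map_smul, smul_sub])
      (by intros; simp only [lie_add, map_add]; abel)
      (by intros; simp only [lie_smul, map_smul, smul_sub])
    have hB : B = 0 := A.basis.ext fun i => A.basis.ext fun j => by
      change ψ ⁅A.e i, A.e j⁆ - ⁅ψ (A.e i), ψ (A.e j)⁆ = 0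
      rw [hψ, hψ, hskew, sub_self]
    exact sub_eq_zero.1 (LinearMap.congr_fun (LinearMap.congr_fun hB x) y)
  let φ : A.Alg ≃ₗ⁅ℝ⁆ V := { ψ with map_lie' := fun {x y} => hlie x y }
  refine ⟨A, J₀, S, φ.symm, h, fun x => ?_⟩
  obtain ⟨y, rfl⟩ := φ.surjective x
  have hIψ : ∀ y : A.Alg, I • ψ y = ψ (J₀ y) := fun y => by
    refine (congrArg (I • ·) (hψ' y)).trans (Eq.trans ?_ (coord_sum (ψ.toLinearMap ∘ₗ J₀) y).symm)
    refine Finset.smul_sum.trans (Finset.sum_congr rfl fun k _ => ?_)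
    rw [smul_comm, hJ]
    exact congrArg _ (hψ' _).symm
  have e1 : φ.symm (I • φ y) = φ.symm (φ (J₀ y)) := congrArg φ.symm (hIψ y)
  exact e1.trans ((φ.symm_apply_apply (J₀ y)).trans (congrArg J₀ (φ.symm_apply_apply y).symm))

/-- The structure constants of a splitting in a complex basis `p, q`. -/
structure HolomorphicSplitting.Frame (D : HolomorphicSplitting V) (p q : V)
    (m₁ m₂ m₃ m₄ m₅ m₆ m₇ m₈ s₁ s₂ : ℂ) : Prop where
  finrank_eq : Module.finrank ℂ V = 2
  indep : LinearIndependent ℂ ![p, q]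
  M_pp : D.M p p = m₁ • p + m₂ • q
  M_pq : D.M p q = m₃ • p + m₄ • q
  M_qp : D.M q p = m₅ • p + m₆ • q
  M_qq : D.M q q = m₇ • p + m₈ • q
  S_pq : D.S p q = s₁ • p + s₂ • q

/-- The effect of a change of basis on the structure constants. -/
theorem HolomorphicSplitting.Frame.change {D : HolomorphicSplitting V} {p q : V}
    {m₁ m₂ m₃ m₄ m₅ m₆ m₇ m₈ s₁ s₂ : ℂ} (F : D.Frame p q m₁ m₂ m₃ m₄ m₅ m₆ m₇ m₈ s₁ s₂)
    {n₁ n₂ n₃ n₄ n₅ n₆ n₇ n₈ t₁ t₂ : ℂ} (α β γ δ : ℂ) (hdet : α * δ - β * γ ≠ 0)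
    (h₁ : conj α * (α * m₁ + β * m₃) + conj β * (α * m₅ + β * m₇) = n₁ * α + n₂ * γ)
    (h₂ : conj α * (α * m₂ + β * m₄) + conj β * (α * m₆ + β * m₈) = n₁ * β + n₂ * δ)
    (h₃ : conj α * (γ * m₁ + δ * m₃) + conj β * (γ * m₅ + δ * m₇) = n₃ * α + n₄ * γ)
    (h₄ : conj α * (γ * m₂ + δ * m₄) + conj β * (γ * m₆ + δ * m₈) = n₃ * β + n₄ * δ)
    (h₅ : conj γ * (α * m₁ + β * m₃) + conj δ * (α * m₅ + β * m₇) = n₅ * α + n₆ * γ)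
    (h₆ : conj γ * (α * m₂ + β * m₄) + conj δ * (α * m₆ + β * m₈) = n₅ * β + n₆ * δ)
    (h₇ : conj γ * (γ * m₁ + δ * m₃) + conj δ * (γ * m₅ + δ * m₇) = n₇ * α + n₈ * γ)
    (h₈ : conj γ * (γ * m₂ + δ * m₄) + conj δ * (γ * m₆ + δ * m₈) = n₇ * β + n₈ * δ)
    (k₁ : (α * δ - β * γ) * s₁ = t₁ * α + t₂ * γ)
    (k₂ : (α * δ - β * γ) * s₂ = t₁ * β + t₂ * δ) :
    D.Frame (α • p + β • q) (γ • p + δ • q) n₁ n₂ n₃ n₄ n₅ n₆ n₇ n₈ t₁ t₂ := by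
  have expand : ∀ {x y x' y' : ℂ}, x = x' → y = y' → x • p + y • q = x' • p + y' • q := by
    rintro x y _ _ rfl rfl
    rfl
  refine ⟨F.finrank_eq, LinearIndependent.pair_iff.2 fun s t hst => ?_, ?_, ?_, ?_, ?_, ?_⟩
  · obtain ⟨e1, e2⟩ := LinearIndependent.pair_iff.1 F.indep (s * α + t * γ) (s * β + t * δ)
      (by rw [← hst]; module)
    exact ⟨(mul_eq_zero.1 (by linear_combination δ * e1 - γ * e2 :
        s * (α * δ - β * γ) = 0)).resolve_right hdet,
      (mul_eq_zero.1 (by linear_combination α * e2 - β * e1 :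
        t * (α * δ - β * γ) = 0)).resolve_right hdet⟩
  all_goals
    simp only [map_add, LinearMap.add_apply, map_smulₛₗ, LinearMap.smul_apply, F.M_pp,
      F.M_pq, F.M_qp, F.M_qq, F.S_pq, D.S_self, D.S_skew q p, RingHom.id_apply]
  · linear_combination (norm := module) expand h₁ h₂
  · linear_combination (norm := module) expand h₃ h₄
  · linear_combination (norm := module) expand h₅ h₆
  · linear_combination (norm := module) expand h₇ h₈
  · linear_combination (norm := module) expand k₁ k₂

/-- The vector a_i p + b_i q plays the role of the i-th basis vector. Real independence, the action
of I and the brackets thereby become identities between complex numbers. -/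
theorem HolomorphicSplitting.Frame.inKahlerTable {D : HolomorphicSplitting V} {p q : V}
    {m₁ m₂ m₃ m₄ m₅ m₆ m₇ m₈ s₁ s₂ : ℂ} (F : D.Frame p q m₁ m₂ m₃ m₄ m₅ m₆ m₇ m₈ s₁ s₂)
    {A : LieName} {J₀ : A.Alg →ₗ[ℝ] A.Alg}
    {S : Set (LinearMap.BilinForm ℝ A.Alg)} (h : KahlerTable A J₀ S) (a b : Fin 4 → ℂ)
    (hab : ∀ g : Fin 4 → ℝ, ∑ i, g i * a i = 0 → ∑ i, g i * b i = 0 → ∀ i, g i = 0)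
    (hJ : ∀ i, I * a i = ∑ k, (J₀ (A.e i)) k * a k ∧ I * b i = ∑ k, (J₀ (A.e i)) k * b k)
    (hbr : ∀ i j, i < j →
      (a i * b j - b i * a j) * s₁ + (conj (a i) * a j - conj (a j) * a i) * m₁
        + (conj (a i) * b j - conj (a j) * b i) * m₃ + (conj (b i) * a j - conj (b j) * a i) * m₅
        + (conj (b i) * b j - conj (b j) * b i) * m₇ =
          ∑ k, A.bracket (A.e i) (A.e j) k * a k ∧
      (a i * b j - b i * a j) * s₂ + (conj (a i) * a j - conj (a j) * a i) * m₂
        + (conj (a i) * b j - conj (a j) * b i) * m₄ + (conj (b i) * a j - conj (b j) * a i) * m₆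
        + (conj (b i) * b j - conj (b j) * b i) * m₈ =
          ∑ k, A.bracket (A.e i) (A.e j) k * b k) :
    InKahlerTable V := by
  have smul_real : ∀ (r : ℝ) (x : V), r • x = (r : ℂ) • x := fun r x =>
    (algebraMap_smul ℂ r x).symm
  have hsum : ∀ g : Fin 4 → ℝ, ∑ i, g i • (a i • p + b i • q) =
      (∑ i, g i * a i) • p + (∑ i, g i * b i) • q := fun g => by
    simp only [Finset.sum_smul, ← Finset.sum_add_distrib, smul_real]
    exact Finset.sum_congr rfl fun i _ => by module
  have hli : LinearIndependent ℝ fun i => a i • p + b i • q := by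
    rw [Fintype.linearIndependent_iff]
    intro g hg
    rw [hsum] at hg
    obtain ⟨h1, h2⟩ := LinearIndependent.pair_iff.1 F.indep _ _ hg
    exact hab g h1 h2
  have hV : Module.finrank ℝ V = 4 := by
    rw [← Module.finrank_mul_finrank ℝ ℂ V, F.finrank_eq, Complex.finrank_real_complex]
  have hb : ∀ i, basisOfLinearIndependentOfCardEqFinrank hli (by rw [hV]; rfl) i =
      a i • p + b i • q := fun i => by simp
  refine inKahlerTable_of_basis h (basisOfLinearIndependentOfCardEqFinrank hli (by rw [hV]; rfl))
    (fun i => ?_) fun i j hij => ?_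
  · simp only [hb]
    refine Eq.trans ?_ (hsum (J₀ (A.e i))).symm
    rw [← (hJ i).1, ← (hJ i).2]
    module
  · simp only [hb]
    refine Eq.trans ?_ (hsum (A.bracket (A.e i) (A.e j))).symm
    rw [← (hbr i j hij).1, ← (hbr i j hij).2]
    simp only [D.lie_eq, map_add, LinearMap.add_apply, map_smulₛₗ, LinearMap.smul_apply, F.M_pp,
      F.M_pq, F.M_qp, F.M_qq, F.S_pq, D.S_self, D.S_skew q p, RingHom.id_apply]
    module

namespace HolomorphicSplitting.Frame

variable {D : HolomorphicSplitting V} {p q : V}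

/-- Since [p, Ip] = 2I M(p,p), the constant -I/2 yields [p, Ip] = q, that is [e₁,e₂] = e₃ with p =
e₁ and q = e₃. The constants of the other normal forms arise in the same way. -/
theorem rh3 (F : D.Frame p q 0 (-I / 2) 0 0 0 0 0 0 0 0) :
    InKahlerTable V := by
  refine F.inKahlerTable .rh3 ![1, I, 0, 0] ![0, 0, 1, I] (fun g h₁ h₂ => ?_) (fun i => ?_) fun i j hij => ?_
  · simp [Fin.sum_univ_four, Complex.ext_iff] at h₁ h₂
    intro i; fin_cases i <;> simp [h₁, h₂]
  · constructor <;> fin_cases i <;>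
      simp [Fin.sum_univ_four, endo_apply, LieName.neg_apply, e_apply]
  · constructor <;> fin_cases i <;> fin_cases j <;> simp at hij <;>
      simp [Fin.sum_univ_four, bracket, e_apply, Complex.ext_iff] <;> ring

theorem rr30 (F : D.Frame p q (1 / 2) 0 0 0 0 0 0 0 0 0) :
    InKahlerTable V := by
  refine F.inKahlerTable .rr30 ![1, I, 0, 0] ![0, 0, 1, I] (fun g h₁ h₂ => ?_) (fun i => ?_) fun i j hij => ?_
  · simp [Fin.sum_univ_four, Complex.ext_iff] at h₁ h₂
    intro i; fin_cases i <;> simp [h₁, h₂]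
  · constructor <;> fin_cases i <;>
      simp [Fin.sum_univ_four, endo_apply, LieName.neg_apply, e_apply]
  · constructor <;> fin_cases i <;> fin_cases j <;> simp at hij <;>
      simp [Fin.sum_univ_four, bracket, e_apply, Complex.ext_iff] <;> ring

theorem rr30' (F : D.Frame p q 0 0 0 (-I / 2) 0 0 0 0 0 (-I / 2)) :
    InKahlerTable V := by
  refine F.inKahlerTable .rr30' ![1, 0, 0, I] ![0, 1, I, 0] (fun g h₁ h₂ => ?_) (fun i => ?_) fun i j hij => ?_
  · simp [Fin.sum_univ_four, Complex.ext_iff] at h₁ h₂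
    intro i; fin_cases i <;> simp [h₁, h₂]
  · constructor <;> fin_cases i <;>
      simp [Fin.sum_univ_four, endo_apply, LieName.neg_apply, e_apply]
  · constructor <;> fin_cases i <;> fin_cases j <;> simp at hij <;>
      simp [Fin.sum_univ_four, bracket, e_apply, Complex.ext_iff] <;> ring

theorem r2r2 (F : D.Frame p q (1 / 2) 0 0 0 0 0 0 (1 / 2) 0 0) :
    InKahlerTable V := by
  refine F.inKahlerTable .r2r2 ![1, I, 0, 0] ![0, 0, 1, I] (fun g h₁ h₂ => ?_) (fun i => ?_) fun i j hij => ?_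
  · simp [Fin.sum_univ_four, Complex.ext_iff] at h₁ h₂
    intro i; fin_cases i <;> simp [h₁, h₂]
  · constructor <;> fin_cases i <;>
      simp [Fin.sum_univ_four, endo_apply, LieName.neg_apply, e_apply]
  · constructor <;> fin_cases i <;> fin_cases j <;> simp at hij <;>
      simp [Fin.sum_univ_four, bracket, e_apply, Complex.ext_iff] <;> ring

theorem r2'_J1 (F : D.Frame p q (1 / 2) 0 0 (1 / 2) 0 (1 / 2) (-1 / 2) 0 0 0) :
    InKahlerTable V := by
  refine F.inKahlerTable .r2'_J1 ![1, 0, I, 0] ![0, 1, 0, I] (fun g h₁ h₂ => ?_) (fun i => ?_) fun i j hij => ?_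
  · simp [Fin.sum_univ_four, Complex.ext_iff] at h₁ h₂
    intro i; fin_cases i <;> simp [h₁, h₂]
  · constructor <;> fin_cases i <;>
      simp [Fin.sum_univ_four, endo_apply, LieName.neg_apply, e_apply]
  · constructor <;> fin_cases i <;> fin_cases j <;> simp at hij <;>
      simp [Fin.sum_univ_four, bracket, e_apply, Complex.ext_iff] <;> ring

theorem r2'_J2 (F : D.Frame p q 0 0 0 1 0 0 0 0 0 0) :
    InKahlerTable V := by
  refine F.inKahlerTable .r2'_J2 ![1, -I, 0, 0] ![0, 0, 1, I] (fun g h₁ h₂ => ?_) (fun i => ?_) fun i j hij => ?_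
  · simp [Fin.sum_univ_four, Complex.ext_iff] at h₁ h₂
    intro i; fin_cases i <;> simp [h₁, h₂]
  · constructor <;> fin_cases i <;>
      simp [Fin.sum_univ_four, endo_apply, LieName.neg_apply, e_apply]
  · constructor <;> fin_cases i <;> fin_cases j <;> simp at hij <;>
      simp [Fin.sum_univ_four, bracket, e_apply]

theorem r4 (F : D.Frame p q (1 / 2) 0 0 (-1 / 2) 0 0 0 0 0 (-1 / 2)) :
    InKahlerTable V := by
  refine F.inKahlerTable .r4 ![I, 0, 0, 1] ![0, 1, I, 0] (fun g h₁ h₂ => ?_) (fun i => ?_) fun i j hij => ?_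
  · simp [Fin.sum_univ_four, Complex.ext_iff] at h₁ h₂
    intro i; fin_cases i <;> simp [h₁, h₂]
  · constructor <;> fin_cases i <;>
      simp [Fin.sum_univ_four, endo_apply, LieName.neg_apply, e_apply]
  · constructor <;> fin_cases i <;> fin_cases j <;> simp at hij <;>
      simp [Fin.sum_univ_four, bracket, e_apply, Complex.ext_iff] <;> ring

theorem r4'_J1 {δ : ℝ} (hδ : 0 < δ) (F : D.Frame p q (1 / 2) 0 0 (-I * δ / 2) 0 0 0 0 0 (-I * δ / 2)) :
    InKahlerTable V := by
  refine F.inKahlerTable (.r4'_J1 δ hδ) ![I, 0, 0, 1] ![0, 1, I, 0] (fun g h₁ h₂ => ?_) (fun i => ?_) fun i j hij => ?_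
  · simp [Fin.sum_univ_four, Complex.ext_iff] at h₁ h₂
    intro i; fin_cases i <;> simp [h₁, h₂]
  · constructor <;> fin_cases i <;>
      simp [Fin.sum_univ_four, endo_apply, LieName.neg_apply, e_apply]
  · constructor <;> fin_cases i <;> fin_cases j <;> simp at hij <;>
      simp [Fin.sum_univ_four, bracket, e_apply, Complex.ext_iff] <;> ring

theorem r4'_J2 {δ : ℝ} (hδ : 0 < δ) (F : D.Frame p q (1 / 2) 0 0 (I * δ / 2) 0 0 0 0 0 (I * δ / 2)) :
    InKahlerTable V := by
  refine F.inKahlerTable (.r4'_J2 δ hδ) ![I, 0, 0, 1] ![0, 1, -I, 0] (fun g h₁ h₂ => ?_) (fun i => ?_) fun i j hij => ?_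
  · simp [Fin.sum_univ_four, Complex.ext_iff] at h₁ h₂
    intro i; fin_cases i <;> simp [h₁, h₂]
  · constructor <;> fin_cases i <;>
      simp [Fin.sum_univ_four, endo_apply, LieName.neg_apply, e_apply]
  · constructor <;> fin_cases i <;> fin_cases j <;> simp at hij <;>
      simp [Fin.sum_univ_four, bracket, e_apply, Complex.ext_iff] <;> ring

theorem d41 (F : D.Frame p q (1 / 2) 0 0 (1 / 2) 0 (1 / 2) 0 0 0 0) :
    InKahlerTable V := by
  refine F.inKahlerTable .d41 ![-I, 0, 0, 1] ![0, 1, I, 0] (fun g h₁ h₂ => ?_) (fun i => ?_) fun i j hij => ?_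
  · simp [Fin.sum_univ_four, Complex.ext_iff] at h₁ h₂
    intro i; fin_cases i <;> simp [h₁, h₂]
  · constructor <;> fin_cases i <;>
      simp [Fin.sum_univ_four, endo_apply, LieName.neg_apply, e_apply]
  · constructor <;> fin_cases i <;> fin_cases j <;> simp at hij <;>
      simp [Fin.sum_univ_four, bracket, e_apply, Complex.ext_iff] <;> ring

theorem d42_J1 (F : D.Frame p q (-1 / 2) 0 0 (1 / 2) 0 (-1 / 2) 0 0 0 1) :
    InKahlerTable V := by
  refine F.inKahlerTable .d42_J1 ![0, -I, 0, 1] ![1, 0, I, 0] (fun g h₁ h₂ => ?_) (fun i => ?_) fun i j hij => ?_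
  · simp [Fin.sum_univ_four, Complex.ext_iff] at h₁ h₂
    intro i; fin_cases i <;> simp [h₁, h₂]
  · constructor <;> fin_cases i <;>
      simp [Fin.sum_univ_four, endo_apply, LieName.neg_apply, e_apply]
  · constructor <;> fin_cases i <;> fin_cases j <;> simp at hij <;>
      simp [Fin.sum_univ_four, bracket, e_apply, Complex.ext_iff] <;> ring

theorem d42_J2 (F : D.Frame p q 1 0 0 (1 / 2) 0 1 0 0 0 (-1 / 2)) :
    InKahlerTable V := by
  -- With p = e₄, the relation J e₄ = -2 e₁ forces e₁ = -(I/2) p.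
  refine F.inKahlerTable .d42_J2 ![-I / 2, 0, 0, 1] ![0, 1, I, 0] (fun g h₁ h₂ => ?_) (fun i => ?_) fun i j hij => ?_
  · simp [Fin.sum_univ_four, Complex.ext_iff] at h₁ h₂
    intro i; fin_cases i <;> simp [h₁, h₂]
  · constructor <;> fin_cases i <;>
      simp [Fin.sum_univ_four, endo_apply, LieName.neg_apply, LieName.smul_apply, e_apply, Complex.ext_iff] <;> norm_num
  · constructor <;> fin_cases i <;> fin_cases j <;> simp at hij <;>
      simp [Fin.sum_univ_four, bracket, e_apply, conj_ofNat, Complex.ext_iff] <;> ring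

theorem d4half_J1 (F : D.Frame p q (1 / 2) 0 0 (1 / 4) 0 0 (1 / 2) 0 0 (1 / 4)) :
    InKahlerTable V := by
  refine F.inKahlerTable .d4half_J1 ![0, 0, I, 1] ![1, I, 0, 0] (fun g h₁ h₂ => ?_) (fun i => ?_) fun i j hij => ?_
  · simp [Fin.sum_univ_four, Complex.ext_iff] at h₁ h₂
    intro i; fin_cases i <;> simp [h₁, h₂]
  · constructor <;> fin_cases i <;>
      simp [Fin.sum_univ_four, endo_apply, LieName.neg_apply, e_apply]
  · constructor <;> fin_cases i <;> fin_cases j <;> simp at hij <;>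
      simp [Fin.sum_univ_four, bracket, e_apply, Complex.ext_iff] <;> ring

theorem d4half_J2 (F : D.Frame p q (1 / 2) 0 0 (1 / 4) 0 0 (-1 / 2) 0 0 (1 / 4)) :
    InKahlerTable V := by
  refine F.inKahlerTable .d4half_J2 ![0, 0, I, 1] ![1, -I, 0, 0] (fun g h₁ h₂ => ?_) (fun i => ?_) fun i j hij => ?_
  · simp [Fin.sum_univ_four, Complex.ext_iff] at h₁ h₂
    intro i; fin_cases i <;> simp [h₁, h₂]
  · constructor <;> fin_cases i <;>
      simp [Fin.sum_univ_four, endo_apply, LieName.neg_apply, e_apply]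
  · constructor <;> fin_cases i <;> fin_cases j <;> simp at hij <;>
      simp [Fin.sum_univ_four, bracket, e_apply, Complex.ext_iff] <;> ring

theorem d4'_J1 {δ : ℝ} (hδ : 0 < δ) (F : D.Frame p q (δ / 2) 0 0 (δ / 4 - I / 2) 0 0 (1 / 2) 0 0 (δ / 4 - I / 2)) :
    InKahlerTable V := by
  refine F.inKahlerTable (.d4'_J1 δ hδ) ![0, 0, I, 1] ![1, I, 0, 0] (fun g h₁ h₂ => ?_) (fun i => ?_) fun i j hij => ?_
  · simp [Fin.sum_univ_four, Complex.ext_iff] at h₁ h₂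
    intro i; fin_cases i <;> simp [h₁, h₂]
  · constructor <;> fin_cases i <;>
      simp [Fin.sum_univ_four, endo_apply, LieName.neg_apply, e_apply]
  · constructor <;> fin_cases i <;> fin_cases j <;> simp at hij <;>
      simp [Fin.sum_univ_four, bracket, e_apply, Complex.ext_iff] <;> (try refine ⟨?_, ?_⟩) <;> ring

theorem d4'_J2 {δ : ℝ} (hδ : 0 < δ) (F : D.Frame p q (δ / 2) 0 0 (δ / 4 - I / 2) 0 0 (-1 / 2) 0 0 (δ / 4 - I / 2)) :
    InKahlerTable V := by
  refine F.inKahlerTable (.d4'_J2 δ hδ) ![0, 0, -I, 1] ![1, I, 0, 0] (fun g h₁ h₂ => ?_) (fun i => ?_) fun i j hij => ?_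
  · simp [Fin.sum_univ_four, Complex.ext_iff] at h₁ h₂
    intro i; fin_cases i <;> simp [h₁, h₂]
  · constructor <;> fin_cases i <;>
      simp [Fin.sum_univ_four, endo_apply, LieName.neg_apply, e_apply]
  · constructor <;> fin_cases i <;> fin_cases j <;> simp at hij <;>
      simp [Fin.sum_univ_four, bracket, e_apply, Complex.ext_iff] <;> (try refine ⟨?_, ?_⟩) <;> ring

theorem d4'_J3 {δ : ℝ} (hδ : 0 < δ) (F : D.Frame p q (δ / 2) 0 0 (δ / 4 + I / 2) 0 0 (1 / 2) 0 0 (δ / 4 + I / 2)) :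
    InKahlerTable V := by
  refine F.inKahlerTable (.d4'_J3 δ hδ) ![0, 0, -I, 1] ![1, -I, 0, 0] (fun g h₁ h₂ => ?_) (fun i => ?_) fun i j hij => ?_
  · simp [Fin.sum_univ_four, Complex.ext_iff] at h₁ h₂
    intro i; fin_cases i <;> simp [h₁, h₂]
  · constructor <;> fin_cases i <;>
      simp [Fin.sum_univ_four, endo_apply, LieName.neg_apply, e_apply]
  · constructor <;> fin_cases i <;> fin_cases j <;> simp at hij <;>
      simp [Fin.sum_univ_four, bracket, e_apply, Complex.ext_iff] <;> (try refine ⟨?_, ?_⟩) <;> ring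

theorem d4'_J4 {δ : ℝ} (hδ : 0 < δ) (F : D.Frame p q (δ / 2) 0 0 (δ / 4 + I / 2) 0 0 (-1 / 2) 0 0 (δ / 4 + I / 2)) :
    InKahlerTable V := by
  refine F.inKahlerTable (.d4'_J4 δ hδ) ![0, 0, I, 1] ![1, -I, 0, 0] (fun g h₁ h₂ => ?_) (fun i => ?_) fun i j hij => ?_
  · simp [Fin.sum_univ_four, Complex.ext_iff] at h₁ h₂
    intro i; fin_cases i <;> simp [h₁, h₂]
  · constructor <;> fin_cases i <;>
      simp [Fin.sum_univ_four, endo_apply, LieName.neg_apply, e_apply]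
  · constructor <;> fin_cases i <;> fin_cases j <;> simp at hij <;>
      simp [Fin.sum_univ_four, bracket, e_apply, Complex.ext_iff] <;> (try refine ⟨?_, ?_⟩) <;> ring

end HolomorphicSplitting.Frame

end Identification

/-! ### Rescaling to the normal forms -/

section NormalForms

open Complex ComplexConjugate

namespace HolomorphicSplitting.Frame

variable {V : Type*} [LieRing V] [LieAlgebra ℝ V] [Module ℂ V] [IsScalarTower ℝ ℂ V]
  {D : HolomorphicSplitting V} {p q : V}

theorem conj_ne_zero {z : ℂ} (hz : z ≠ 0) : conj z ≠ 0 := (map_ne_zero _).2 hz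

/-- Products of two algebras of dimension two. -/
theorem inKahlerTable_product {a f : ℂ}
    (F : D.Frame p q (-conj a) 0 0 0 0 0 0 (-conj f) 0 0) (h : a ≠ 0 ∨ f ≠ 0) :
    InKahlerTable V := by
  by_cases ha : a = 0
  · have hf : f ≠ 0 := h.resolve_left (not_not.2 ha)
    have hf' := conj_ne_zero hf
    subst ha
    refine (F.change 0 (-1 / (2 * f)) 1 0 ?_ ?_ ?_ ?_ ?_ ?_ ?_ ?_ ?_ ?_ ?_).rr30 <;>
      simp [hf, conj_ofNat]
    field_simp
  · have ha' := conj_ne_zero ha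
    by_cases hf : f = 0
    · subst hf
      -- Scaling p by λ multiplies the constant of M(p,p) by conj λ; this λ turns -conj a into 1/2.
      refine (F.change (-1 / (2 * a)) 0 0 1 ?_ ?_ ?_ ?_ ?_ ?_ ?_ ?_ ?_ ?_ ?_).rr30 <;>
        simp [ha, conj_ofNat]
      field_simp
    · have hf' := conj_ne_zero hf
      refine (F.change (-1 / (2 * a)) 0 0 (-1 / (2 * f)) ?_ ?_ ?_ ?_ ?_ ?_ ?_ ?_ ?_ ?_ ?_).r2r2 <;>
        simp [ha, hf, conj_ofNat] <;> field_simp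

/-- The hypothesis says that b / f has real part zero. -/
theorem exists_real_of_conj_add {b f : ℂ} (hf : f ≠ 0) (h : conj f * b + f * conj b = 0) :
    ∃ τ : ℝ, b = I * τ * f := by
  have hf' := conj_ne_zero hf
  have h1 : conj (-I * (b / f)) = -I * (b / f) := by
    simp only [map_mul, map_neg, conj_I, map_div₀]
    field_simp
    linear_combination h
  obtain ⟨τ, hτ⟩ := conj_eq_iff_real.1 h1
  refine ⟨τ, ?_⟩
  rw [← hτ]
  field_simp
  linear_combination b * I_sq

/-- A plane of rotations. -/
theorem inKahlerTable_rotation {b f : ℂ}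
    (F : D.Frame p q (-conj f) 0 0 (-conj b) 0 0 0 0 0 b) (hb : b ≠ 0)
    (h : conj f * b + f * conj b = 0) : InKahlerTable V := by
  have hb' := conj_ne_zero hb
  by_cases hf : f = 0
  · subst hf
    refine (F.change (-I / (2 * b)) 0 0 1 ?_ ?_ ?_ ?_ ?_ ?_ ?_ ?_ ?_ ?_ ?_).rr30' <;>
      simp [hb, conj_ofNat] <;> field_simp
  · have hf' := conj_ne_zero hf
    obtain ⟨τ, rfl⟩ := exists_real_of_conj_add hf h
    have hτ : τ ≠ 0 := fun h0 => hb (by simp [h0])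
    -- Here δ = |τ|, and the sign of τ decides between the two complex structures.
    rcases hτ.lt_or_gt with hneg | hpos
    · refine Frame.r4'_J2 (neg_pos.2 hneg)
        (F.change (-1 / (2 * f)) 0 0 1 ?_ ?_ ?_ ?_ ?_ ?_ ?_ ?_ ?_ ?_ ?_) <;>
        simp [hf, conj_ofNat] <;> field_simp
    · refine Frame.r4'_J1 hpos
        (F.change (-1 / (2 * f)) 0 0 1 ?_ ?_ ?_ ?_ ?_ ?_ ?_ ?_ ?_ ?_ ?_) <;>
        simp [hf, conj_ofNat] <;> field_simp

/-- Algebras of complex hyperbolic type. -/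
theorem inKahlerTable_hyperbolic {b f : ℂ} {ε : ℝ}
    (F : D.Frame p q (-conj f) 0 0 (-conj b) 0 0 (-ε * conj f) 0 0 (b - f)) (hf : f ≠ 0)
    (hε : ε ≠ 0) (h : f * conj f = b * conj f + f * conj b) : InKahlerTable V := by
  have hf' := conj_ne_zero hf
  -- The hypothesis `h` says that b / f has real part 1/2.
  obtain ⟨τ, hτ⟩ := exists_real_of_conj_add (b := b - f / 2) hf (by
    simp only [map_sub, map_div₀, conj_ofNat]
    linear_combination -h)
  obtain rfl : b = (1 / 2 + I * τ) * f := by linear_combination hτ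
  -- Multiplying q by `r` normalises the constant of M(q,q) to absolute value 1/2; the factor √z
  -- compensates the scaling of p by -z/f.
  obtain ⟨r, hr, hr'⟩ : ∃ r : ℝ, r ≠ 0 ∧ (r : ℂ) * r * (2 * (|ε| : ℝ) * (f * conj f)) = 1 := by
    have hpos : 0 < 2 * |ε| * normSq f := by
      have := normSq_pos.2 hf
      positivity
    refine ⟨1 / Real.sqrt (2 * |ε| * normSq f), by positivity, ?_⟩
    rw [mul_conj]
    norm_cast
    field_simp
    rw [Real.sq_sqrt hpos.le]
  have key : ∀ (z : ℝ) (m x u : ℂ), 0 < z → m = z → x = z * (1 / 2 - I * τ) →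
      2 * (|ε| : ℝ) * u = ε → D.Frame ((-z / f) • p + (0 : ℂ) • q)
        ((0 : ℂ) • p + ((Real.sqrt z * r : ℝ) : ℂ) • q) m 0 0 x 0 0 u 0 0 x := by
    rintro z _ _ u hz rfl rfl hu
    have hz' : (z : ℂ) ≠ 0 := ofReal_ne_zero.2 hz.ne'
    have hsq : (Real.sqrt z : ℂ) * Real.sqrt z = z := by
      norm_cast
      exact Real.mul_self_sqrt hz.le
    refine F.change _ _ _ _ ?_ ?_ ?_ ?_ ?_ ?_ ?_ ?_ ?_ ?_ ?_
    all_goals simp only [map_div₀, map_neg, map_mul, map_add, conj_ofReal, conj_I, map_zero,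
      zero_mul, mul_zero, add_zero, zero_add, map_one, conj_ofNat, ofReal_mul, sub_zero]
    · have := (Real.sqrt_pos.2 hz).ne'
      simp [hz', hf, hr, this]
    · field_simp
    · field_simp
      ring
    · rw [← hu, mul_div_assoc', eq_div_iff hf]
      linear_combination -u * (Real.sqrt z : ℂ) * Real.sqrt z * hr' - u * hsq
    · field_simp
      ring
  -- τ = 0 gives `d4 (1 / 2)`, and τ ≠ 0 gives `d4' δ` with δ = 1/|τ|. The signs of τ and ε select
  -- the complex structure.
  rcases lt_trichotomy τ 0 with hτ' | rfl | hτ'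
  · have hδ : 0 < -1 / τ := div_pos_of_neg_of_neg (by norm_num) hτ'
    have hτ₀ : (τ : ℂ) ≠ 0 := ofReal_ne_zero.2 hτ'.ne
    have hx : ((-1 / τ : ℝ) : ℂ) / 4 + I / 2 = ((-1 / τ / 2 : ℝ) : ℂ) * (1 / 2 - I * τ) := by
      push_cast
      field_simp
      ring
    rcases hε.lt_or_gt with hε' | hε'
    · exact Frame.d4'_J4 hδ (key _ _ _ _ (half_pos hδ) (by push_cast; ring) hx (by
        rw [abs_of_neg hε']; push_cast; ring))
    · exact Frame.d4'_J3 hδ (key _ _ _ _ (half_pos hδ) (by push_cast; ring) hx (by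
        rw [abs_of_pos hε']; ring))
  · rcases hε.lt_or_gt with hε' | hε'
    · exact Frame.d4half_J2 (key (1 / 2) _ _ _ (by norm_num) (by push_cast; ring)
        (by push_cast; ring) (by rw [abs_of_neg hε']; push_cast; ring))
    · exact Frame.d4half_J1 (key (1 / 2) _ _ _ (by norm_num) (by push_cast; ring)
        (by push_cast; ring) (by rw [abs_of_pos hε']; ring))
  · have hδ : 0 < 1 / τ := one_div_pos.2 hτ'
    have hτ₀ : (τ : ℂ) ≠ 0 := ofReal_ne_zero.2 hτ'.ne'
    have hx : ((1 / τ : ℝ) : ℂ) / 4 - I / 2 = ((1 / τ / 2 : ℝ) : ℂ) * (1 / 2 - I * τ) := by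
      push_cast
      field_simp
      ring
    rcases hε.lt_or_gt with hε' | hε'
    · exact Frame.d4'_J2 hδ (key _ _ _ _ (half_pos hδ) (by push_cast; ring) hx (by
        rw [abs_of_neg hε']; push_cast; ring))
    · exact Frame.d4'_J1 hδ (key _ _ _ _ (half_pos hδ) (by push_cast; ring) hx (by
        rw [abs_of_pos hε']; ring))

/-- Algebras of type `d_{4,2}` with a positive complex structure. -/
theorem inKahlerTable_d42 {d u : ℂ}
    (F : D.Frame p q (-2 * conj d) 0 0 (-conj d) 0 (-conj u) 0 0 0 d) (hd : d ≠ 0)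
    (h : u * conj u = 4 * (d * conj d)) : InKahlerTable V := by
  have hd' := conj_ne_zero hd
  have hu : u ≠ 0 := by
    rintro rfl
    simp [hd, hd'] at h
  have hu' := conj_ne_zero hu
  -- By `h`, ζ = conj u / (2d) has modulus 1, and ζ conj ρ = ρ is solved by ρ = 1 + ζ, or by ρ = I
  -- when ζ = -1.
  obtain ⟨ρ, hρ, hρ'⟩ : ∃ ρ : ℂ, ρ ≠ 0 ∧ conj ρ * conj u = 2 * ρ * d := by
    by_cases hud : 2 * d + conj u = 0
    · refine ⟨I, I_ne_zero, ?_⟩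
      simp only [conj_I]
      linear_combination -I * hud
    · refine ⟨(2 * d + conj u) / (2 * d), div_ne_zero hud (by simpa using hd), ?_⟩
      simp only [map_div₀, map_add, map_mul, conj_ofNat, conj_conj]
      field_simp
      linear_combination h
  refine (F.change (-1 / (2 * d)) 0 0 ρ ?_ ?_ ?_ ?_ ?_ ?_ ?_ ?_ ?_ ?_ ?_).d42_J2 <;>
    simp [hd, hρ, conj_ofNat] <;> field_simp
  linear_combination hρ'

end HolomorphicSplitting.Frame

end NormalForms

/-! ### Frames with a null eigenvector -/

section NullFrames

open Complex ComplexConjugate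

theorem exists_eq_smul_add_smul {V : Type*} [AddCommGroup V] [Module ℂ V]
    (hV : Module.finrank ℂ V = 2) {p q : V} (h : LinearIndependent ℂ ![p, q]) (x : V) :
    ∃ α β : ℂ, x = α • p + β • q := by
  let B := basisOfLinearIndependentOfCardEqFinrank h (by rw [hV]; rfl)
  refine ⟨B.repr x 0, B.repr x 1, ?_⟩
  conv_lhs => rw [← B.sum_repr x]
  simp [B, Fin.sum_univ_two]

namespace HolomorphicSplitting.Frame

variable {V : Type*} [LieRing V] [LieAlgebra ℝ V] [Module ℂ V] [IsScalarTower ℝ ℂ V]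
  {D : HolomorphicSplitting V} {p q : V}

/-- The Jacobi identity in terms of the structure constants. -/
theorem jacobi {m₁ m₂ m₃ m₄ m₅ m₆ m₇ m₈ s₁ s₂ : ℂ}
    (F : D.Frame p q m₁ m₂ m₃ m₄ m₅ m₆ m₇ m₈ s₁ s₂) :
    (m₆ * m₃ - m₂ * m₇ = conj s₁ * m₁ + conj s₂ * m₅ ∧
      m₅ * m₂ + m₆ * m₄ - m₁ * m₆ - m₂ * m₈ = conj s₁ * m₂ + conj s₂ * m₆) ∧
    (m₇ * m₁ + m₈ * m₃ - m₃ * m₅ - m₄ * m₇ = conj s₁ * m₃ + conj s₂ * m₇ ∧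
      m₇ * m₂ - m₃ * m₆ = conj s₁ * m₄ + conj s₂ * m₈) ∧
    (s₂ * m₃ = m₄ * s₁ + conj m₅ * m₁ + conj m₆ * m₅ - conj m₁ * m₃ - conj m₂ * m₇ ∧
      s₁ * m₂ = m₁ * s₂ + conj m₅ * m₂ + conj m₆ * m₆ - conj m₁ * m₄ - conj m₂ * m₈) ∧
    (s₂ * m₇ = m₈ * s₁ + conj m₇ * m₁ + conj m₈ * m₅ - conj m₃ * m₃ - conj m₄ * m₇ ∧
      s₁ * m₆ = m₅ * s₂ + conj m₇ * m₂ + conj m₈ * m₆ - conj m₃ * m₄ - conj m₄ * m₈) := by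
  have key : ∀ {s t s' t' : ℂ}, (s - s') • p + (t - t') • q = 0 → s = s' ∧ t = t' := fun h => by
    obtain ⟨h1, h2⟩ := LinearIndependent.pair_iff.1 F.indep _ _ h
    exact ⟨sub_eq_zero.1 h1, sub_eq_zero.1 h2⟩
  have e₁ := D.M_commutator p q p
  have e₂ := D.M_commutator p q q
  have e₃ := D.M_S p q p
  have e₄ := D.M_S p q q
  simp only [map_add, LinearMap.add_apply, map_smulₛₗ, LinearMap.smul_apply, F.M_pp,
    F.M_pq, F.M_qp, F.M_qq, F.S_pq, D.S_self, RingHom.id_apply] at e₁ e₂ e₃ e₄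
  refine ⟨key ?_, key ?_, key ?_, key ?_⟩
  · linear_combination (norm := module) e₁
  · linear_combination (norm := module) e₂
  · linear_combination (norm := module) e₃
  · linear_combination (norm := module) e₄

theorem isLieAbelian (F : D.Frame p q 0 0 0 0 0 0 0 0 0 0) : IsLieAbelian V := by
  refine ⟨fun x y => ?_⟩
  obtain ⟨α, β, rfl⟩ := exists_eq_smul_add_smul F.finrank_eq F.indep x
  obtain ⟨γ, δ, rfl⟩ := exists_eq_smul_add_smul F.finrank_eq F.indep y
  simp [D.lie_eq, map_smulₛₗ, F.M_pp, F.M_pq, F.M_qp, F.M_qq, F.S_pq, D.S_self, D.S_skew q p]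

/-- The classification when the metric has a null vector `p` which is an eigenvector of all
`M x`. -/
theorem inKahlerTable_null {a b c d e f : ℂ} (F : D.Frame p q (-conj d) 0 (-conj c) (-conj a)
      (-conj f) 0 (-conj e) (-conj b) (c - b) d) (hV : ¬ IsLieAbelian V) : InKahlerTable V := by
  obtain ⟨⟨E₃, -⟩, ⟨E₂, E₁⟩, ⟨E₅, E₄⟩, E₇, E₆⟩ := F.jacobi
  replace E₁ := congrArg conj E₁
  replace E₂ := congrArg conj E₂
  replace E₃ := congrArg conj E₃
  simp only [map_sub, map_add, map_mul, map_neg, map_zero, conj_conj] at E₁ E₂ E₃ E₄ E₅ E₆ E₇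
  replace E₁ : (c - b) * a + d * b = 0 := by linear_combination E₁
  replace E₂ : c * (c - f) + 2 * d * e - e * a = 0 := by linear_combination E₂
  replace E₃ : d * (c - b + f) = 0 := by linear_combination E₃
  replace E₄ : d * conj (a + d) = 0 := by simp only [map_add]; linear_combination E₄
  replace E₅ : conj a * (c - b) - f * conj d = 0 := by linear_combination E₅
  replace E₆ : conj f * d + c * conj a + a * conj b = 0 := by linear_combination E₆
  replace E₇ : conj b * (c - b) - b * conj f + c * conj c + a * conj e - d * conj e
      - e * conj d = 0 := by linear_combination E₇
  by_cases hd : d = 0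
  · subst hd
    by_cases ha : a = 0
    · subst ha
      by_cases hc : c = 0
      · subst hc
        by_cases hb : b = 0
        · subst hb
          by_cases hf : f = 0
          · subst hf
            by_cases he : e = 0
            · subst he
              simp only [map_zero, neg_zero, sub_zero] at F
              exact absurd F.isLieAbelian hV
            · refine (F.change 0 1 (-2 * I * conj e) 0 ?_ ?_ ?_ ?_ ?_ ?_ ?_ ?_ ?_ ?_ ?_).rh3 <;>
                simp [he, conj_ofNat]
              linear_combination conj e * I_sq
          · have hf' := conj_ne_zero hf
            -- The q-component normalises `f`; the p-component is chosen to absorb `e`. The changes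
            -- of basis in the next branches follow the same pattern.
            refine (F.change (conj e / (f * conj f)) (-1 / f) 1 0
              ?_ ?_ ?_ ?_ ?_ ?_ ?_ ?_ ?_ ?_ ?_).r2'_J2 <;>
              simp [hf]; field_simp
            all_goals ring
        · have hf' : f = -b := by
            have h : b * conj (b + f) = 0 := by
              simp only [map_zero] at E₇
              simp only [map_add]
              linear_combination -E₇
            have h := (map_eq_zero conj).1 ((mul_eq_zero.1 h).resolve_left hb)
            linear_combination h
          subst hf'
          have hb' := conj_ne_zero hb
          refine (F.change (-conj e / (4 * b * conj b)) (-1 / (2 * b)) 1 0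
              ?_ ?_ ?_ ?_ ?_ ?_ ?_ ?_ ?_ ?_ ?_).r4 <;>
              simp [hb, conj_ofNat] <;> field_simp
          all_goals ring
      · obtain rfl : c = f := by
          exact sub_eq_zero.1 ((mul_eq_zero.1 (by linear_combination E₂)).resolve_left hc)
        have hc' := conj_ne_zero hc
        -- The real part of `E₇` gives |b| = |c| and its imaginary part says that b conj c is real,
        -- so b = ±c.
        have hbc : (b - c) * (b + c) = 0 := by
          have E₇' := congrArg conj E₇
          simp only [map_sub, map_add, map_mul, map_zero, conj_conj] at E₇ E₇'
          refine (mul_eq_zero.1 ?_).resolve_left hc'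
          linear_combination (-b / 2 - c / 2) * E₇ + (b / 2 - c / 2) * E₇'
        rcases mul_eq_zero.1 hbc with h | h
        · obtain rfl : b = c := by linear_combination h
          refine (F.change (e / (2 * b ^ 2)) (-1 / (2 * b)) (conj b) 0
              ?_ ?_ ?_ ?_ ?_ ?_ ?_ ?_ ?_ ?_ ?_).d41 <;>
              simp [hc, conj_ofNat] <;> field_simp
          all_goals ring
        · obtain rfl : b = -c := by linear_combination h
          refine (F.change (-1 / (2 * c) * (2 * (-conj e / conj c) + e / c) / 3) (-1 / (2 * c))
              (I * conj c) 0 ?_ ?_ ?_ ?_ ?_ ?_ ?_ ?_ ?_ ?_ ?_).d42_J1 <;>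
              simp [hc, conj_ofNat] <;> field_simp
          all_goals ring
    · have ha' := conj_ne_zero ha
      obtain rfl : c = b := by
        refine sub_eq_zero.1 ((mul_eq_zero.1 ?_).resolve_left ha')
        rw [map_zero] at E₅
        linear_combination E₅
      have hab : c * conj a + conj c * a = 0 := by linear_combination E₆
      obtain rfl : e = c * (c - f) / a := by
        field_simp
        linear_combination -E₂
      -- Shifting q by -(c/a) p removes both `c` and `e`.
      have F' : D.Frame ((1 : ℂ) • p + (0 : ℂ) • q) ((-c / a) • p + (1 : ℂ) • q)
          0 0 0 (-conj a) (-conj f) 0 0 0 0 0 := by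
        refine F.change 1 0 (-c / a) 1 ?_ ?_ ?_ ?_ ?_ ?_ ?_ ?_ ?_ ?_ ?_ <;>
          simp [ha] <;> field_simp
        all_goals first | ring1 | linear_combination hab | linear_combination conj f * hab
      by_cases hf : f = 0
      · subst hf
        refine (F'.change (-1 / a) 0 0 1 ?_ ?_ ?_ ?_ ?_ ?_ ?_ ?_ ?_ ?_ ?_).r2'_J2 <;>
              simp [ha]
      · have hf' := conj_ne_zero hf
        -- With P = -p/a and Q = -q/f one has M_P Q = Q and M_Q P = P; the new basis is (P + Q)/2,
        -- I(P - Q)/2.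
        refine (F'.change (-1 / (2 * a)) (-1 / (2 * f)) (-I / (2 * a)) (I / (2 * f))
          (by field_simp; norm_num [ha, hf]) ?_ ?_ ?_ ?_ ?_ ?_ ?_ ?_ ?_ ?_).r2'_J1 <;>
              simp [conj_ofNat] <;> field_simp
        all_goals first | ring1 | linear_combination -I_sq
  · have hd' := conj_ne_zero hd
    obtain rfl : a = -d := by
      have h := (map_eq_zero conj).1 ((mul_eq_zero.1 E₄).resolve_left hd)
      linear_combination h
    obtain rfl : c = 2 * b := by
      have h : d * (c - 2 * b) = 0 := by linear_combination -E₁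
      exact sub_eq_zero.1 ((mul_eq_zero.1 h).resolve_left hd)
    obtain rfl : f = -b := by
      have h := (mul_eq_zero.1 E₃).resolve_left hd
      linear_combination h
    have hbd : conj b * d + b * conj d = 0 := by
      simp only [map_neg] at E₆
      linear_combination (-1 / 2) * E₆
    obtain rfl : e = -2 * b ^ 2 / d := by
      field_simp
      linear_combination E₂ / 3
    refine (F.change (-1 / (2 * d)) 0 (b / d) 1 ?_ ?_ ?_ ?_ ?_ ?_ ?_ ?_ ?_ ?_ ?_).r4 <;>
        simp [hd, conj_ofNat] <;> field_simp
    all_goals first | ring1 | linear_combination 2 * hbd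

end HolomorphicSplitting.Frame

end NullFrames

/-! ### Frames with a non-null eigenvector -/

section NonNullFrames

open Complex ComplexConjugate

namespace HolomorphicSplitting.Frame

variable {V : Type*} [LieRing V] [LieAlgebra ℝ V] [Module ℂ V] [IsScalarTower ℝ ℂ V]
  {D : HolomorphicSplitting V} {p q : V}

/-- The classification when the metric has a non-null vector `q` which is an eigenvector of all
`M x`. Here `p` is orthogonal to `q` and `ε` is the quotient of the norms of `p` and `q`. -/
theorem inKahlerTable_nonNull {a b c d e f : ℂ} {ε : ℝ} (hε : ε ≠ 0)
    (F : D.Frame p q (-conj a) (-ε * conj c) 0 (-conj d) (-conj b) (-ε * conj e) 0 (-conj f)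
      (c - b) d) (hV : ¬ IsLieAbelian V) : InKahlerTable V := by
  have hε' : (ε : ℂ) ≠ 0 := ofReal_ne_zero.2 hε
  obtain ⟨⟨E₁, E₂⟩, ⟨-, E₃⟩, ⟨E₆, E₇⟩, E₄, E₅⟩ := F.jacobi
  replace E₁ := congrArg conj E₁
  replace E₂ := congrArg conj E₂
  replace E₃ := congrArg conj E₃
  simp only [map_sub, map_add, map_mul, map_neg, map_zero, conj_conj, conj_ofReal]
    at E₁ E₂ E₃ E₄ E₅ E₆ E₇
  replace E₁ : (c - b) * a + d * b = 0 := by linear_combination E₁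
  replace E₂ : c ^ 2 + 2 * d * e = e * a + f * c :=
    mul_left_cancel₀ hε' (by linear_combination E₂)
  replace E₃ : d * (c - b + f) = 0 := by linear_combination E₃
  replace E₄ : conj f * (c - b) = f * conj b := by linear_combination E₄
  replace E₅ : ε * conj e * (c - b + f) = d * (conj b + conj f) := by linear_combination -E₅
  replace E₆ : conj d * (c - b) = conj a * b + ε * e * conj b := by linear_combination E₆
  replace E₇ : ε * c * conj c + ε ^ 2 * e * conj e = conj a * d + a * conj d + ε * c * conj f := by
    linear_combination -E₇
  -- If this factor is nonzero, then `E₃` and `E₅` force d = e = 0, leaving products, rotations and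
  -- the hyperbolic type.
  by_cases hg : c - b + f = 0
  · obtain rfl : c = b - f := by linear_combination hg
    by_cases hf : f = 0
    · subst hf
      by_cases hb : b = 0
      · subst hb
        by_cases he : e = 0
        · subst he
          by_cases hd : d = 0
          · subst hd
            by_cases ha : a = 0
            · subst ha
              simp only [map_zero, neg_zero, sub_zero, mul_zero] at F
              exact absurd F.isLieAbelian hV
            · simp only [map_zero, neg_zero, sub_zero, mul_zero] at F
              exact inKahlerTable_product (a := a) (f := 0) (by simpa using F) (Or.inl ha)
          · simp only [map_zero, neg_zero, sub_zero, mul_zero] at F E₇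
            exact F.inKahlerTable_rotation hd (by linear_combination -E₇)
        · obtain rfl : a = 2 * d := mul_left_cancel₀ he (by linear_combination -E₂)
          simp only [map_zero, map_mul, conj_ofNat, sub_zero, mul_zero] at E₇
          have hd : d ≠ 0 := by
            rintro rfl
            have := conj_ne_zero he
            exact absurd E₇ (by simp [hε', he])
          refine inKahlerTable_d42 (d := d) (u := ε * e) (by simpa [conj_ofNat] using F) hd ?_
          simp only [map_mul, conj_ofReal]
          linear_combination E₇
      · have hb' := conj_ne_zero hb
        obtain rfl : d = 0 := by
          refine (mul_eq_zero.1 ?_).resolve_right hb'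
          simp only [map_zero] at E₅
          linear_combination -E₅
        have E₂' := congrArg conj E₂
        have E₆' := congrArg conj E₆
        simp only [map_sub, map_add, map_mul, map_zero, conj_conj, conj_ofReal, map_pow]
          at E₂ E₂' E₆ E₆'
        refine (F.change 0 (-1 / b) b (-a)
          ?_ ?_ ?_ ?_ ?_ ?_ ?_ ?_ ?_ ?_ ?_).r2'_J2 <;> simp [hb] <;> field_simp
        all_goals first | ring1 | linear_combination E₆' | linear_combination -(b * ε) * E₂'
    · have hf' := conj_ne_zero hf
      obtain rfl : b = -f := by
        have h : f * conj (b + f) = 0 := by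
          simp only [map_add]
          linear_combination -E₄
        have h := (map_eq_zero conj).1 ((mul_eq_zero.1 h).resolve_left hf)
        linear_combination h
      obtain rfl : d = -a := mul_left_cancel₀ hf (by linear_combination -E₁)
      have E₂' := congrArg conj E₂
      have E₆' := congrArg conj E₆
      simp only [map_sub, map_add, map_mul, map_neg, conj_conj, conj_ofReal, map_pow,
        conj_ofNat] at E₂ E₂' E₆ E₆'
      refine (F.change 0 (-1 / (2 * f)) f a
          ?_ ?_ ?_ ?_ ?_ ?_ ?_ ?_ ?_ ?_ ?_).r4 <;> simp [hf, conj_ofNat] <;> field_simp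
      all_goals first | (simp; done) | ring1 | linear_combination E₆' | linear_combination f * ε / 3 * E₂'
  · obtain rfl : d = 0 := (mul_eq_zero.1 E₃).resolve_right hg
    obtain rfl : e = 0 := by
      refine (map_eq_zero conj).1 ((mul_eq_zero.1 ?_).resolve_left hε')
      exact (mul_eq_zero.1 (by linear_combination E₅)).resolve_right hg
    by_cases ha : a = 0
    · subst ha
      by_cases hc : c = 0
      · subst hc
        by_cases hb : b = 0
        · subst hb
          exact inKahlerTable_product (a := 0) (f := f) (by simpa using F)
            (Or.inr fun h => hg (by simp [h]))
        · refine inKahlerTable_rotation (b := b) (f := f)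
            (F.change 0 1 1 0 ?_ ?_ ?_ ?_ ?_ ?_ ?_ ?_ ?_ ?_ ?_) hb ?_
          all_goals try simp
          linear_combination -E₄
      · obtain rfl : c = f := mul_left_cancel₀ hc (by linear_combination E₂)
        refine inKahlerTable_hyperbolic (b := b) (f := c) (ε := ε)
            (F.change 0 1 1 0 ?_ ?_ ?_ ?_ ?_ ?_ ?_ ?_ ?_ ?_ ?_) hc hε ?_
        all_goals try simp
        linear_combination E₄
    · obtain rfl : b = 0 := by
        simp only [map_zero] at E₆
        refine (mul_eq_zero.1 ?_).resolve_left (conj_ne_zero ha)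
        linear_combination -E₆
      obtain rfl : c = 0 := mul_right_cancel₀ ha (by linear_combination E₁)
      exact inKahlerTable_product (a := a) (f := f) (by simpa using F) (Or.inl ha)

end HolomorphicSplitting.Frame

end NonNullFrames

/-! ### The hermitian form and the choice of an adapted frame -/

section Classification

open Complex ComplexConjugate

variable {V : Type*} [LieRing V] [LieAlgebra ℝ V] [Module ℂ V] [IsScalarTower ℝ ℂ V]

/-- The pseudo-hermitian form of a symplectic form which is invariant under `I`. -/
theorem exists_hermitian {ω : LinearMap.BilinForm ℝ V} (hω : IsSymplecticStructure ω)
    (hI : ∀ x y, ω (I • x) (I • y) = ω x y) :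
    ∃ h : V →ₗ[ℂ] V →ₛₗ[starRingEnd ℂ] ℂ, (∀ x y, h x y = ω x (I • y) - I * ω x y) ∧
      (∀ x y, h y x = conj (h x y)) ∧ ∀ x, (∀ y, h x y = 0) → x = 0 := by
  obtain ⟨halt, -, hnd⟩ := hω
  have skew : ∀ x y, ω y x = -ω x y := fun x y => by
    have := halt (x + y)
    simp only [map_add, LinearMap.add_apply, halt] at this
    linarith
  have hI' : ∀ x y, ω (I • x) y = -ω x (I • y) := fun x y => by
    rw [← hI x (I • y), I_smul_I_smul, map_neg, neg_neg]
  let h₀ : V →ₗ[ℝ] V →ₗ[ℝ] ℂ := LinearMap.mk₂ ℝ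
    (fun x y => (ω x (I • y) : ℂ) - I * ω x y)
    (by intros; simp only [map_add, LinearMap.add_apply, ofReal_add]; ring)
    (by intros; simp only [map_smul, LinearMap.smul_apply, smul_eq_mul, ofReal_mul, real_smul]; ring)
    (by intros; simp only [map_add, smul_add, ofReal_add]; ring)
    (by
      intro c x y
      rw [smul_comm I c y]
      simp only [map_smul, smul_eq_mul, ofReal_mul, real_smul]; ring)
  have h_apply : ∀ x y, h₀ x y = (ω x (I • y) : ℂ) - I * ω x y := fun _ _ => rfl
  have h1 : ∀ x y, h₀ (I • x) y = I • h₀ x y := fun x y => by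
    rw [h_apply, h_apply, hI, hI', smul_eq_mul]
    push_cast
    linear_combination (ω x y : ℂ) * I_sq
  have h2 : ∀ x y, h₀ x (I • y) = -(I • h₀ x y) := fun x y => by
    rw [h_apply, h_apply, I_smul_I_smul, map_neg, smul_eq_mul]
    push_cast
    linear_combination -(ω x y : ℂ) * I_sq
  let h : V →ₗ[ℂ] V →ₛₗ[starRingEnd ℂ] ℂ := LinearMap.mk₂'ₛₗ _ _ (fun x y => h₀ x y)
    (fun x y z => by rw [map_add, LinearMap.add_apply])
    (fun c x y => map_complex_smul (h₀.flip y) (fun x => h1 x y) c x)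
    (fun x y z => map_add _ _ _)
    (fun c x y => map_conj_smul (h₀ x) (h2 x) c y)
  refine ⟨h, h_apply, fun x y => ?_, fun x hx => hnd x fun y => ?_⟩
  · change h₀ y x = conj (h₀ x y)
    rw [h_apply, h_apply, skew x y, skew (I • x) y, hI']
    simp
  · have := congrArg im (hx y)
    change (h₀ x y).im = 0 at this
    rw [h_apply] at this
    simpa using this

namespace HolomorphicSplitting

variable (D : HolomorphicSplitting V)

/-- By `M_commutator` the operators of two basis vectors have a commutator in their span, with the
conjugated coordinates of S as coefficients. Conjugate-linearity extends the common eigenvector to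
all `M x`. -/
theorem exists_eigenvector (hV : Module.finrank ℂ V = 2) :
    ∃ w ≠ 0, ∀ x, ∃ c : ℂ, D.M x w = c • w := by
  have : FiniteDimensional ℂ V := Module.finite_of_finrank_eq_succ hV
  let B := Module.finBasisOfFinrankEq ℂ V hV
  have hB : ∀ x, x = B.repr x 0 • B 0 + B.repr x 1 • B 1 := fun x => by
    conv_lhs => rw [← B.sum_repr x]
    rw [Fin.sum_univ_two]
  obtain ⟨w, hw, ⟨r, hr⟩, s, hs⟩ := exists_common_eigenvector hV (D.M (B 0)) (D.M (B 1))
    (conj (B.repr (D.S (B 0) (B 1)) 0)) (conj (B.repr (D.S (B 0) (B 1)) 1)) (by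
      ext t
      have h := D.M_commutator (B 0) (B 1) t
      rw [hB (D.S (B 0) (B 1))] at h
      simpa only [map_add, map_smulₛₗ, LinearMap.add_apply, LinearMap.smul_apply] using! h)
  refine ⟨w, hw, fun x => ⟨conj (B.repr x 0) * r + conj (B.repr x 1) * s, ?_⟩⟩
  conv_lhs => rw [hB x]
  simp only [map_add, map_smulₛₗ, LinearMap.add_apply, LinearMap.smul_apply, hr, hs]
  module

variable {D} {h : V →ₗ[ℂ] V →ₛₗ[starRingEnd ℂ] ℂ}

/-- A null q with h(p,q) = 1 completes p to a basis; pairing `hD` with q and with p then gives the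
two coordinates of S(p,q) in terms of M. -/
theorem inKahlerTable_of_null (hV : Module.finrank ℂ V = 2) (hab : ¬ IsLieAbelian V)
    (hconj : ∀ x y, h y x = conj (h x y)) (hnd : ∀ x, (∀ y, h x y = 0) → x = 0)
    (hD : ∀ x y z, h (D.S x y) z = h x (D.M y z) - h y (D.M x z))
    {p : V} (hp : p ≠ 0) (heig : ∀ x, ∃ c : ℂ, D.M x p = c • p) (hpp : h p p = 0) :
    InKahlerTable V := by
  obtain ⟨y, hy⟩ : ∃ y, h p y = 1 := by
    by_contra! hcon
    refine hp (hnd p fun y => ?_)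
    by_contra hy
    refine hcon (conj (1 / h p y) • y) ?_
    rw [map_smulₛₗ, conj_conj, smul_eq_mul, one_div_mul_cancel hy]
  obtain ⟨q, hpq, hqq⟩ : ∃ q, h p q = 1 ∧ h q q = 0 := by
    have hy' := hconj p y
    rw [hy, map_one] at hy'
    have hyy := hconj y y
    -- Since h(y,y) is real and h(p,y) = 1, subtracting half of it along p makes the vector null.
    refine ⟨y - (h y y / 2) • p, ?_, ?_⟩
    · simp [map_sub, map_smulₛₗ, hpp, hy]
    · simp [map_sub, map_smulₛₗ, hpp, hy, hy', ← hyy, conj_ofNat]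
      ring
  have hqp := hconj p q
  rw [hpq, map_one] at hqp
  have ind : LinearIndependent ℂ ![p, q] := LinearIndependent.pair_iff.2 fun s t hst => by
    have h1 := congrArg (fun x => h x q) hst
    have h2 := congrArg (fun x => h x p) hst
    simp [hpq, hqq, hpp, hqp] at h1 h2
    exact ⟨h1, h2⟩
  obtain ⟨m₁, e₁⟩ := heig p
  obtain ⟨m₅, e₅⟩ := heig q
  obtain ⟨m₃, m₄, e₃⟩ := exists_eq_smul_add_smul hV ind (D.M p q)
  obtain ⟨m₇, m₈, e₇⟩ := exists_eq_smul_add_smul hV ind (D.M q q)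
  obtain ⟨s₁, s₂, es⟩ := exists_eq_smul_add_smul hV ind (D.S p q)
  have k₁ := hD p q q
  have k₂ := hD p q p
  rw [es, e₃, e₇] at k₁
  rw [es, e₁, e₅] at k₂
  simp [hpq, hqq, hpp, hqp] at k₁ k₂
  subst k₁ k₂
  refine Frame.inKahlerTable_null (D := D) (p := p) (q := q) (a := -conj m₄) (b := -conj m₈)
    (c := -conj m₃) (d := -conj m₁) (e := -conj m₇) (f := -conj m₅) ?_ hab
  refine ⟨hV, ind, ?_, ?_, ?_, ?_, ?_⟩
  · simp [e₁]
  · simp [e₃]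
  · simp [e₅]
  · simp [e₇]
  · rw [es]
    module

/-- A vector p orthogonal to q is non-null by nondegeneracy. Both norms are real, and their quotient
is the ε of the frame. -/
theorem inKahlerTable_of_nonNull (hV : Module.finrank ℂ V = 2) (hab : ¬ IsLieAbelian V)
    (hconj : ∀ x y, h y x = conj (h x y)) (hnd : ∀ x, (∀ y, h x y = 0) → x = 0)
    (hD : ∀ x y z, h (D.S x y) z = h x (D.M y z) - h y (D.M x z))
    {q : V} (heig : ∀ x, ∃ c : ℂ, D.M x q = c • q) (hqq : h q q ≠ 0) :
    InKahlerTable V := by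
  obtain ⟨p, hp, hpq⟩ : ∃ p ≠ 0, h p q = 0 := by
    obtain ⟨y, hy⟩ : ∃ y, ∀ c : ℂ, c • q ≠ y := by
      by_contra! hcon
      have := finrank_le_one q hcon
      omega
    refine ⟨y - (h y q / h q q) • q, fun h0 => hy _ (sub_eq_zero.1 h0).symm, ?_⟩
    simp [hqq]
  have hqp := hconj p q
  rw [hpq, map_zero] at hqp
  have ind : LinearIndependent ℂ ![p, q] := LinearIndependent.pair_iff.2 fun s t hst => by
    have h1 := congrArg (fun x => h x q) hst
    simp [hpq, hqq] at h1
    subst h1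
    simpa [hp] using hst
  have hpp : h p p ≠ 0 := fun hpp => hp <| hnd p fun y => by
    obtain ⟨α, β, rfl⟩ := exists_eq_smul_add_smul hV ind y
    simp [hpp, hpq]
  obtain ⟨P, hP⟩ := conj_eq_iff_real.1 (hconj p p).symm
  obtain ⟨Q, hQ⟩ := conj_eq_iff_real.1 (hconj q q).symm
  have hP₀ : (P : ℂ) ≠ 0 := hP ▸ hpp
  have hQ₀ : (Q : ℂ) ≠ 0 := hQ ▸ hqq
  obtain ⟨m₄, e₄⟩ := heig p
  obtain ⟨m₈, e₈⟩ := heig q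
  obtain ⟨m₁, m₂, e₁⟩ := exists_eq_smul_add_smul hV ind (D.M p p)
  obtain ⟨m₅, m₆, e₅⟩ := exists_eq_smul_add_smul hV ind (D.M q p)
  obtain ⟨s₁, s₂, es⟩ := exists_eq_smul_add_smul hV ind (D.S p q)
  have k₁ := hD p q p
  have k₂ := hD p q q
  rw [es, e₁, e₅] at k₁
  rw [es, e₄, e₈] at k₂
  simp [hpq, hqp, hP, hQ] at k₁ k₂
  have k₂' : s₂ = -conj m₄ := mul_right_cancel₀ hQ₀ (by linear_combination k₂)
  refine Frame.inKahlerTable_nonNull (D := D) (p := p) (q := q) (ε := P / Q) (a := -conj m₁)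
    (b := -conj m₅) (c := -conj m₂ * Q / P) (d := -conj m₄) (e := -conj m₆ * Q / P)
    (f := -conj m₈) ?_ ?_ hab
  · exact div_ne_zero (ofReal_ne_zero.1 hP₀) (ofReal_ne_zero.1 hQ₀)
  refine ⟨hV, ind, ?_, ?_, ?_, ?_, ?_⟩
  · rw [e₁]
    congr 2 <;> simp
    field_simp
  · simp [e₄]
  · rw [e₅]
    congr 2 <;> simp
    field_simp
  · simp [e₈]
  · rw [es, ← k₂']
    congr 2
    field_simp
    linear_combination k₁

end HolomorphicSplitting

theorem inKahlerTable_of_symplectic (hV : Module.finrank ℂ V = 2) (hab : ¬ IsLieAbelian V)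
    (hN : ∀ x y : V, ⁅I • x, I • y⁆ - ⁅x, y⁆ - I • ⁅I • x, y⁆ - I • ⁅x, I • y⁆ = 0)
    {ω : LinearMap.BilinForm ℝ V} (hω : IsSymplecticStructure ω)
    (hI : ∀ x y, ω (I • x) (I • y) = ω x y) : InKahlerTable V := by
  obtain ⟨D, hD⟩ := exists_holomorphicSplitting hN
  obtain ⟨h, h_apply, hconj, hnd⟩ := exists_hermitian hω hI
  -- The identity passes from ω to h because each `D.M x` commutes with I.
  have hD' : ∀ x y z, h (D.S x y) z = h x (D.M y z) - h y (D.M x z) := fun x y z => by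
    simp only [h_apply, hD ω hω hI, map_smul]
    push_cast
    ring
  obtain ⟨w, hw, heig⟩ := D.exists_eigenvector hV
  by_cases hww : h w w = 0
  · exact HolomorphicSplitting.inKahlerTable_of_null hV hab hconj hnd hD' hw heig hww
  · exact HolomorphicSplitting.inKahlerTable_of_nonNull hV hab hconj hnd hD' heig hww

end Classification

theorem exists_kahlerTable_equiv {g : Type*} [LieRing g] [LieAlgebra ℝ g]
    (hg : Module.finrank ℝ g = 4) (hab : ¬ IsLieAbelian g) {J : g →ₗ[ℝ] g}
    {ω : LinearMap.BilinForm ℝ g} (hJ : IsKahlerStructure J ω) :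
    ∃ (A : LieName) (J₀ : A.Alg →ₗ[ℝ] A.Alg) (S : Set (LinearMap.BilinForm ℝ A.Alg))
      (φ : g ≃ₗ⁅ℝ⁆ A.Alg), KahlerTable A J₀ S ∧ ∀ x, φ (J x) = J₀ (φ x) := by
  obtain ⟨⟨hJ₂, hN⟩, hω, hinv⟩ := hJ
  -- J² = -1 lets ℂ act with I acting as J, so g becomes a complex plane.
  let Φ : ℂ →ₐ[ℝ] Module.End ℝ g := Complex.lift ⟨J, LinearMap.ext hJ₂⟩
  let _ : Module ℂ g := Module.compHom g Φ.toRingHom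
  have hsmul : ∀ (c : ℂ) (x : g), c • x = Φ c x := fun _ _ => rfl
  have hI : ∀ x : g, Complex.I • x = J x := fun x => by
    rw [hsmul]
    simp [Φ]
  have : IsScalarTower ℝ ℂ g := ⟨fun r c x => by
    rw [hsmul, hsmul, map_smul, LinearMap.smul_apply]⟩
  have hV : Module.finrank ℂ g = 2 := by
    have := Module.finrank_mul_finrank ℝ ℂ g
    rw [Complex.finrank_real_complex, hg] at this
    omega
  obtain ⟨A, J₀, S, φ, hT, hφ⟩ := inKahlerTable_of_symplectic hV hab
    (by simpa only [hI] using hN) hω (by simpa only [hI] using hinv)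
  exact ⟨A, J₀, S, φ, hT, fun x => by rw [← hφ, hI]⟩

theorem KahlerTable.not_isLieAbelian {A : LieName} {J : A.Alg →ₗ[ℝ] A.Alg}
    {S : Set (LinearMap.BilinForm ℝ A.Alg)} (h : KahlerTable A J S) : ¬ IsLieAbelian A.Alg := by
  intro hab
  have key : ∀ i j k : Fin 4, A.bracket (Pi.single i 1) (Pi.single j 1) k = 0 := fun i j k => by
    have h := congrFun (trivial_lie_zero A.Alg A.Alg (A.e i) (A.e j)) k
    rwa [lie_eq_bracket, e_eq_single, e_eq_single] at h
  -- Each algebra of the table has a nonzero entry among these four components of brackets.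
  have h₁ := key 0 1 1
  have h₂ := key 0 1 2
  have h₃ := key 0 2 2
  have h₄ := key 3 0 0
  cases h <;> simp [bracket] at h₁ h₂ h₃ h₄

theorem LieName.finrank_alg (A : LieName) : Module.finrank ℝ A.Alg = 4 := by
  rw [Module.finrank_eq_card_basis A.basis, Fintype.card_fin]

/-- A symplectic structure invariant under `J` is transported to an invariant one. -/
theorem comp_mem_compatibleSymplectic {g g' : Type*} [LieRing g] [LieAlgebra ℝ g] [LieRing g']
    [LieAlgebra ℝ g'] (ψ : g' ≃ₗ⁅ℝ⁆ g) {J : g →ₗ[ℝ] g} {J' : g' →ₗ[ℝ] g'}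
    (hψ : ∀ x, ψ (J' x) = J (ψ x)) {ω : LinearMap.BilinForm ℝ g}
    (hω : ω ∈ compatibleSymplectic J) :
    ω.compl₁₂ (ψ : g' →ₗ[ℝ] g) (ψ : g' →ₗ[ℝ] g) ∈ compatibleSymplectic J' := by
  obtain ⟨⟨halt, hcl, hnd⟩, hinv⟩ := hω
  refine ⟨⟨fun x => halt _, fun x y z => ?_, fun x hx => ?_⟩, fun x y => ?_⟩
  · simpa [LieEquiv.map_lie] using hcl (ψ x) (ψ y) (ψ z)
  · refine ψ.injective ((hnd _ fun y => ?_).trans (map_zero (ψ : g' →ₗ[ℝ] g)).symm)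
    obtain ⟨y, rfl⟩ := ψ.surjective y
    exact hx y
  · simpa [hψ] using hinv (ψ x) (ψ y)

end KahlerLieAlgebras

theorem mainTheorem1 :
    -- every non-abelian four-dimensional Kähler Lie algebra is isomorphic to one in the table
    (∀ (g : Type*) [LieRing g] [LieAlgebra ℝ g], Module.finrank ℝ g = 4 → ¬ IsLieAbelian g →
      ∀ (J : g →ₗ[ℝ] g) (ω : LinearMap.BilinForm ℝ g), IsKahlerStructure J ω →
        ∃ (A : LieName) (J₀ : A.Alg →ₗ[ℝ] A.Alg) (S : Set (LinearMap.BilinForm ℝ A.Alg))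
          (φ : g ≃ₗ⁅ℝ⁆ A.Alg), KahlerTable A J₀ S ∧ (∀ x, φ (J x) = J₀ (φ x)) ∧
            ∃ ω₀ ∈ S, ∀ x y, ω x y = ω₀ (φ x) (φ y)) ∧
    -- on each Lie algebra of the table, every complex structure that admits a compatible symplectic
    -- form is equivalent to one listed for that Lie algebra
    (∀ (A : LieName), (∃ J₁ S₁, KahlerTable A J₁ S₁) →
      ∀ (J : A.Alg →ₗ[ℝ] A.Alg), IsComplexStructure J → (compatibleSymplectic J).Nonempty →
        ∃ (J₀ : A.Alg →ₗ[ℝ] A.Alg) (S : Set (LinearMap.BilinForm ℝ A.Alg))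
          (φ : A.Alg ≃ₗ⁅ℝ⁆ A.Alg), KahlerTable A J₀ S ∧ ∀ x, φ (J x) = J₀ (φ x)) ∧
    -- each listed endomorphism is a complex structure, and its compatible symplectic forms are
    -- exactly the listed two-forms
    (∀ (A : LieName) (J₀ : A.Alg →ₗ[ℝ] A.Alg) (S : Set (LinearMap.BilinForm ℝ A.Alg)),
      KahlerTable A J₀ S → IsComplexStructure J₀ ∧ compatibleSymplectic J₀ = S) := by
  refine ⟨fun g _ _ hg hab J ω hJ => ?_, fun A ⟨J₁, S₁, h₁⟩ J hJ ⟨ω, hω⟩ => ?_,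
    fun A J₀ S h => h.isComplexStructure_and_compatibleSymplectic_eq⟩
  · obtain ⟨A, J₀, S, φ, h, hφ⟩ := exists_kahlerTable_equiv hg hab hJ
    refine ⟨A, J₀, S, φ, h, hφ, ω.compl₁₂ (φ.symm : A.Alg →ₗ[ℝ] g) (φ.symm : A.Alg →ₗ[ℝ] g), ?_,
      fun x y => by simp⟩
    -- By (iii) the listed forms are all the compatible ones, so it suffices that the transported ω
    -- is compatible with `J₀`.
    rw [← h.isComplexStructure_and_compatibleSymplectic_eq.2]
    refine comp_mem_compatibleSymplectic φ.symm (fun x => ?_) hJ.2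
    obtain ⟨y, rfl⟩ := φ.surjective x
    change φ.symm (J₀ (φ y)) = J (φ.symm (φ y))
    rw [← hφ, φ.symm_apply_apply, φ.symm_apply_apply]
  · obtain ⟨A', J₀, S, φ, h, hφ⟩ :=
      exists_kahlerTable_equiv A.finrank_alg h₁.not_isLieAbelian ⟨hJ, hω⟩
    -- The trace invariants identify the target with `A`, so φ becomes an automorphism.
    obtain rfl := eq_of_equiv_of_kahlerTable h₁ h φ
    exact ⟨J₀, S, φ, h, hφ⟩
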